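/- Fix an integer $d\ge 1$. For $k\ge 1$ let $X_k$ be an operator on $(\mathbb C^d)^{\otimes k}$, written as a matrix $(x_{\alpha,\beta})$ indexed by the words $\alpha,\beta$ of length $k$ in the letters $1,\dots,d$ (with respect to the basis $e_\alpha=e_{\alpha(1)}\otimes\cdots\otimes e_{\alpha(k)}$). Assume that $X=(X_k)_{k\ge 1}$ is admissible: $X_k\ge 0$ for all $k$, $X_1$ is invertible, and $\limsup_k\|X_k\|^{1/k}<\infty$. *Weighted Drury–Arveson space and weighted shift.* Put $R_0=I$ on $\mathbb C$ and, for $k\ge 1$, $$R_k=\Big(\sum_{l=1}^{k}\ \sum_{c_1+\cdots+c_l=k,\ c_i\ge 1} X_{c_1}\otimes\cdots\otimes X_{c_l}\Big)^{1/2},\qquad Z_k=R_k^{-1}(I_{\mathbb C^d}\otimes R_{k-1}).$$ Let $\mathcal F(\mathbb C^d)=\bigoplus_{k\ge 0}(\mathbb C^d)^{\otimes k}$ be the full Fock space, and let $\tilde W_i$ $(1\le i\le d)$ be the bounded operator on it with $\tilde W_i\theta=Z_{k+1}(e_i\otimes\theta)$ for $\theta\in(\mathbb C^d)^{\otimes k}$.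 Let $\mathcal F(\mathcal R)=\bigoplus_{k\ge 0}R_k\big(\mathrm{Sym}^k(\mathbb C^d)\big)\subseteq\mathcal F(\mathbb C^d)$, where $\mathrm{Sym}^k(\mathbb C^d)\subseteq(\mathbb C^d)^{\otimes k}$ is the space of symmetric tensors (and $\mathbb C$ for $k=0$), and let $W_i=P_{\mathcal F(\mathcal R)}\tilde W_i|_{\mathcal F(\mathcal R)}$. *The class $\overline D_{cp}(X,H)$.* Let $H$ be a complex Hilbert space. For $T=(T_1,\dots,T_d)$ in $B(H)^d$ put $T_\alpha=T_{\alpha(1)}\cdots T_{\alpha(k)}$ for a word $\alpha$ of length $k$, and $$\Phi_T(a)=\sum_{k\ge 1}\ \sum_{|\alpha|=|\beta|=k}x_{\alpha,\beta}\,T_\alpha\, a\, T_\beta^*\qquad(a\in B(H)).$$ Then $T\in\overline D_{cp}(X,H)$ means that the $T_i$ commute with each other, that the series (over $k$) for $\Phi_T(I)$ converges weak-$*$ (so that $\Phi_T(a)$ is defined for every $a\in B(H)$), that $\|\Phi_T(I)\|\le 1$, and that $T$ is pure: $\Phi_T^m(I)$ decreases strongly to $0$ as $m\to\infty$. **Theorem.**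 Let $T\in\overline D_{cp}(X,H)$ and let $\mathcal S\subseteq H$ be a closed subspace. Then $T_i\mathcal S\subseteq\mathcal S$ for all $1\le i\le d$ if and only if there are a Hilbert space $\mathcal D$ and a partial isometry $\Pi\in B(\mathcal F(\mathcal R)\otimes\mathcal D,\,H)$ (Hilbert space tensor product) such that $$T_i\Pi=\Pi(W_i\otimes I_{\mathcal D})\quad(1\le i\le d)\qquad\text{and}\qquad \mathcal S=\Pi(\mathcal F(\mathcal R)\otimes\mathcal D).$$ -/

import Mathlib

namespace WeightedDruryArveson

open scoped ENNReal TensorProduct InnerProductSpace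

/-! ### Tensor powers and admissible sequences -/

section Weights

open scoped MatrixOrder ComplexOrder Kronecker
open Matrix Filter

/-- The tensor power `(ℂ^d)^{⊗k}`, with its orthonormal basis `e_α` indexed by the words `α` of
length `k` in the letters `Fin d`. -/
abbrev TensorPow (d k : ℕ) : Type := EuclideanSpace ℂ (Fin k → Fin d)

/-- Operators on `(ℂ^d)^{⊗k}`, written as matrices `(x_{α,β})` indexed by words of length `k`. -/
abbrev WordMatrix (d k : ℕ) : Type := Matrix (Fin k → Fin d) (Fin k → Fin d) ℂ

/-- Admissible sequences `(X_k)_{k ≥ 1}`, where `X_k` is a positive operator on `(ℂ^d)^{⊗k}`, `X_1`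
is invertible and `limsup ‖X_k‖^{1/k} < ∞` for the operator norm. The entry `X 0` is never used. -/
structure IsAdmissible {d : ℕ} (X : ∀ k : ℕ, WordMatrix d k) : Prop where
  posSemidef : ∀ k : ℕ, 1 ≤ k → (X k).PosSemidef
  isUnit_one : IsUnit (X 1)
  limsup_lt_top :
    limsup (fun k : ℕ =>
      ENNReal.ofReal ‖Matrix.toEuclideanCLM (𝕜 := ℂ) (X k)‖ ^ (1 / (k : ℝ))) atTop < ⊤

/-- `⨂_i X_{c(i)}` on `(ℂ^d)^{⊗k}` for a composition `c` of `k` into positive parts: the `i`-th factor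
acts on the `i`-th block of consecutive letters. -/
def tensorBlocks {d : ℕ} (X : ∀ k : ℕ, WordMatrix d k) {k : ℕ} (c : Composition k) :
    WordMatrix d k :=
  Matrix.of fun α β =>
    ∏ i : Fin c.length, X (c.blocksFun i) (α ∘ c.embedding i) (β ∘ c.embedding i)

/-- `R_k² = ∑_{l=1}^k ∑_{c(1)+⋯+c(l)=k} X_{c(1)} ⊗ ⋯ ⊗ X_{c(l)}` for `k ≥ 1`. For `k = 0` only the
empty composition occurs, and `R_0² = 1`. -/
def RSq {d : ℕ} (X : ∀ k : ℕ, WordMatrix d k) (k : ℕ) : WordMatrix d k :=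
  ∑ c : Composition k, tensorBlocks X c

/-- `R_k`, the positive square root. -/
noncomputable def R {d : ℕ} (X : ∀ k : ℕ, WordMatrix d k) (k : ℕ) : WordMatrix d k :=
  CFC.sqrt (RSq X k)

/-- `I_{ℂ^d} ⊗ A` on `(ℂ^d)^{⊗(k+1)}` for `A` on `(ℂ^d)^{⊗k}`. -/
def idTensor {d k : ℕ} (A : WordMatrix d k) : WordMatrix d (k + 1) :=
  ((1 : Matrix (Fin d) (Fin d) ℂ) ⊗ₖ A).submatrix
    (fun α => (α 0, Fin.tail α)) (fun β => (β 0, Fin.tail β))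

/-- `Z_0 = I` and `Z_k = R_k⁻¹ (I_{ℂ^d} ⊗ R_{k-1})`. -/
noncomputable def Z {d : ℕ} (X : ∀ k : ℕ, WordMatrix d k) : ∀ k : ℕ, WordMatrix d k
  | 0 => 1
  | k + 1 => (R X (k + 1))⁻¹ * idTensor (R X k)

/-! The sequence `Z` of an admissible sequence is bounded. -/

theorem tensorBlocks_posSemidef {d : ℕ} {X : ∀ k : ℕ, WordMatrix d k} (hX : IsAdmissible X)
    {k : ℕ} (c : Composition k) : (tensorBlocks X c).PosSemidef := by
  have key : ∀ s : Finset (Fin c.length),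
      (Matrix.of fun α β : Fin k → Fin d =>
        ∏ i ∈ s, X (c.blocksFun i) (α ∘ c.embedding i) (β ∘ c.embedding i)).PosSemidef := by
    intro s
    classical
    induction s using Finset.induction_on with
    | empty =>
      have h := Matrix.posSemidef_conjTranspose_mul_self
        (Matrix.of fun (_ : Fin 1) (_ : Fin k → Fin d) => (1 : ℂ))
      refine (congrArg Matrix.PosSemidef ?_).mp h
      ext α β
      simp [Matrix.mul_apply]
    | insert a s ha ih =>
      have h := ((hX.posSemidef _ (c.one_le_blocksFun a)).submatrix
        (fun α : Fin k → Fin d => α ∘ c.embedding a)).hadamard ih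
      refine (congrArg Matrix.PosSemidef ?_).mp h
      ext α β
      simp [Finset.prod_insert ha]
  exact key Finset.univ

theorem idTensor_eq {d k : ℕ} (A : WordMatrix d k) :
    idTensor A = ((1 : Matrix (Fin d) (Fin d) ℂ) ⊗ₖ A).submatrix
      (Fin.consEquiv (fun _ : Fin (k + 1) => Fin d)).symm
      (Fin.consEquiv (fun _ : Fin (k + 1) => Fin d)).symm := rfl

theorem idTensor_mul {d k : ℕ} (A B : WordMatrix d k) :
    idTensor A * idTensor B = idTensor (A * B) := by
  rw [idTensor_eq, idTensor_eq, idTensor_eq, Matrix.submatrix_mul_equiv,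
    ← Matrix.mul_kronecker_mul, Matrix.one_mul]

/-- Prepending a part of size one to a composition. -/
def consOne {k : ℕ} (c : Composition k) : Composition (k + 1) where
  blocks := 1 :: c.blocks
  blocks_pos := by
    intro i hi
    rcases List.mem_cons.1 hi with rfl | h
    · exact Nat.one_pos
    · exact c.blocks_pos h
  blocks_sum := by rw [List.sum_cons, c.blocks_sum, Nat.add_comm]

theorem consOne_injective {k : ℕ} : Function.Injective (consOne (k := k)) := by
  intro c c' h
  have := congrArg Composition.blocks h
  simp only [consOne, List.cons.injEq, true_and] at this
  exact Composition.ext this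

theorem tensorBlocks_consOne {d : ℕ} (X : ∀ k : ℕ, WordMatrix d k) {k : ℕ} (c : Composition k)
    (α β : Fin (k + 1) → Fin d) :
    tensorBlocks X (consOne c) α β =
      X 1 (fun _ => α 0) (fun _ => β 0) * tensorBlocks X c (Fin.tail α) (Fin.tail β) := by
  have h0 : ∀ γ : Fin (k + 1) → Fin d,
      (γ ∘ (consOne c).embedding (0 : Fin (c.length + 1)) : Fin 1 → Fin d) = fun _ => γ 0 := by
    intro γ
    funext j
    have : (consOne c).embedding (0 : Fin (c.length + 1)) j = 0 := by
      refine Fin.ext ?_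
      have hj : (j : ℕ) = 0 := Nat.lt_one_iff.1 j.2
      change (consOne c).sizeUpTo 0 + (j : ℕ) = 0
      rw [hj, Composition.sizeUpTo_zero]
    exact congrArg γ this
  have hs : ∀ (γ : Fin (k + 1) → Fin d) (i : Fin c.length),
      (γ ∘ (consOne c).embedding i.succ : Fin (c.blocksFun i) → Fin d) =
        Fin.tail γ ∘ c.embedding i := by
    intro γ i
    funext j
    have : (consOne c).embedding i.succ j = (c.embedding i j).succ := by
      refine Fin.ext ?_
      change (consOne c).sizeUpTo ((i : ℕ) + 1) + (j : ℕ) = c.sizeUpTo i + (j : ℕ) + 1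
      have : (consOne c).sizeUpTo ((i : ℕ) + 1) = 1 + c.sizeUpTo i := by
        simp [Composition.sizeUpTo, consOne]
      omega
    exact congrArg γ this
  have h := Fin.prod_univ_succ (fun i : Fin (c.length + 1) =>
    X ((consOne c).blocksFun i) (α ∘ (consOne c).embedding i) (β ∘ (consOne c).embedding i))
  refine h.trans ?_
  refine congrArg₂ (· * ·) ?_ (Finset.prod_congr rfl fun i _ => ?_)
  · exact congrArg₂ (X 1) (h0 α) (h0 β)
  · exact congrArg₂ (X (c.blocksFun i)) (hs α i) (hs β i)

theorem exists_smul_one_le {d : ℕ} {X : ∀ k : ℕ, WordMatrix d k} (hX : IsAdmissible X) :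
    ∃ r : ℝ, 0 < r ∧ (X 1 - algebraMap ℝ (WordMatrix d 1) r).PosSemidef := by
  rcases subsingleton_or_nontrivial (WordMatrix d 1) with h | h
  · refine ⟨1, one_pos, ?_⟩
    rw [Subsingleton.elim (X 1 - algebraMap ℝ (WordMatrix d 1) 1) 0]
    exact Matrix.PosSemidef.zero
  · have hp : IsStrictlyPositive (X 1) :=
      hX.isUnit_one.isStrictlyPositive (hX.posSemidef 1 le_rfl).nonneg
    obtain ⟨r, hr, hle⟩ := (CFC.exists_pos_algebraMap_le_iff (a := X 1)
      hp.isSelfAdjoint).2 ((StarOrderedRing.isStrictlyPositive_iff_spectrum_pos (X 1)).1 hp)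
    exact ⟨r, hr, hle⟩

theorem idTensor_RSq_le {d : ℕ} {X : ∀ k : ℕ, WordMatrix d k} (hX : IsAdmissible X) :
    ∃ r : ℝ, 0 < r ∧ ∀ k, (RSq X (k + 1) - r • idTensor (RSq X k)).PosSemidef := by
  obtain ⟨r, hr, hle⟩ := exists_smul_one_le hX
  refine ⟨r, hr, fun k => ?_⟩
  have h1 : (∑ c : Composition k, tensorBlocks X (consOne c) -
      r • idTensor (RSq X k)).PosSemidef := by
    have hR : (RSq X k).PosSemidef :=
      Matrix.posSemidef_sum _ fun c _ => tensorBlocks_posSemidef hX c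
    have h := ((hle.submatrix (fun (a : Fin d) (_ : Fin 1) => a)).kronecker hR).submatrix
      (fun α : Fin (k + 1) → Fin d => (α 0, Fin.tail α))
    refine (congrArg Matrix.PosSemidef ?_).mp h
    ext α β
    have hone : ((1 : WordMatrix d 1) (fun _ => α 0) (fun _ => β 0)) =
        (1 : Matrix (Fin d) (Fin d) ℂ) (α 0) (β 0) := by
      by_cases hab : α 0 = β 0
      · rw [hab, Matrix.one_apply_eq, Matrix.one_apply_eq]
      · rw [Matrix.one_apply_ne hab, Matrix.one_apply_ne]
        exact fun hf => hab (congrFun hf 0)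
    simp only [Matrix.sub_apply, Matrix.sum_apply, tensorBlocks_consOne, Matrix.smul_apply,
      idTensor, Matrix.submatrix_apply, Matrix.kroneckerMap_apply, Algebra.algebraMap_eq_smul_one,
      RSq, ← Finset.mul_sum, hone, Complex.real_smul]
    ring
  have h2 : (RSq X (k + 1) - ∑ c : Composition k, tensorBlocks X (consOne c)).PosSemidef := by
    classical
    have : RSq X (k + 1) - ∑ c : Composition k, tensorBlocks X (consOne c) =
        ∑ c ∈ Finset.univ \ Finset.univ.image (consOne (k := k)), tensorBlocks X c := by
      rw [RSq, ← Finset.sum_sdiff (Finset.subset_univ (Finset.univ.image (consOne (k := k)))),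
        Finset.sum_image consOne_injective.injOn, add_sub_cancel_right]
    rw [this]
    exact Matrix.posSemidef_sum _ fun c _ => tensorBlocks_posSemidef hX c
  have := h2.add h1
  rwa [sub_add_sub_cancel] at this

theorem RSq_posDef {d : ℕ} {X : ∀ k : ℕ, WordMatrix d k} (hX : IsAdmissible X) (k : ℕ) :
    (RSq X k).PosDef := by
  induction k with
  | zero =>
    have : RSq X 0 = 1 := by
      have : Subsingleton (Composition 0) :=
        ⟨fun a b => Composition.ext
          ((a.blocks_eq_nil.2 rfl).trans (b.blocks_eq_nil.2 rfl).symm)⟩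
      ext α β
      rw [Subsingleton.elim β α, RSq, Matrix.sum_apply, Matrix.one_apply_eq,
        Fintype.sum_subsingleton _ (⟨[], by simp, rfl⟩ : Composition 0)]
      rfl
    rw [this]
    exact Matrix.PosDef.one
  | succ k ih =>
    obtain ⟨r, hr, hle⟩ := idTensor_RSq_le hX
    have h : (idTensor (RSq X k)).PosDef := by
      rw [idTensor_eq]
      exact (Matrix.PosDef.one.kronecker ih).submatrix
        (Fin.consEquiv (fun _ : Fin (k + 1) => Fin d)).symm.injective
    have := Matrix.PosDef.posSemidef_add (hle k) (h.smul hr)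
    rwa [sub_add_cancel] at this

open scoped Matrix.Norms.L2Operator in
theorem exists_norm_Z_le {d : ℕ} {X : ∀ k : ℕ, WordMatrix d k} (hX : IsAdmissible X) :
    ∃ C : ℝ, ∀ k, ‖Matrix.toEuclideanCLM (𝕜 := ℂ) (Z X k)‖ ≤ C := by
  obtain ⟨r, hr, hle⟩ := idTensor_RSq_le hX
  have hpos : ∀ k, 0 ≤ RSq X k := fun k => (RSq_posDef hX k).posSemidef.nonneg
  have hRR : ∀ k, R X k * R X k = RSq X k := fun k => CFC.sqrt_mul_sqrt_self _ (hpos k)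
  have hRh : ∀ k, (R X k)ᴴ = R X k := fun k => (CFC.sqrt_nonneg (RSq X k)).posSemidef.isHermitian
  refine ⟨1 + 1 / r, fun k => ?_⟩
  rw [Matrix.l2_opNorm_toEuclideanCLM]
  have hsq : ‖Z X k‖ * ‖Z X k‖ ≤ max 1 (1 / r) := by
    rw [← CStarRing.norm_self_mul_star]
    cases k with
    | zero =>
      refine le_trans ?_ (le_max_left _ _)
      rw [CStarAlgebra.norm_le_one_iff_of_nonneg _ (mul_star_self_nonneg _)]
      simp [Z]
    | succ k =>
      refine le_trans ?_ (le_max_right _ _)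
      have hu : IsUnit (R X (k + 1)).det := by
        have h := (Matrix.isUnit_iff_isUnit_det _).1 (RSq_posDef hX (k + 1)).isUnit
        rw [← hRR, Matrix.det_mul] at h
        exact isUnit_of_mul_isUnit_left h
      have hZ : Z X (k + 1) * star (Z X (k + 1)) =
          (R X (k + 1))⁻¹ * idTensor (RSq X k) * (R X (k + 1))⁻¹ := by
        have hid : (idTensor (R X k))ᴴ = idTensor (R X k) := by
          rw [idTensor_eq, Matrix.conjTranspose_submatrix, Matrix.conjTranspose_kronecker, hRh,
            Matrix.conjTranspose_one]
        rw [Z, Matrix.star_eq_conjTranspose, Matrix.conjTranspose_mul,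
          Matrix.conjTranspose_nonsing_inv, hRh, hid, ← hRR k, ← idTensor_mul]
        simp only [Matrix.mul_assoc]
      have hle1 : r • (Z X (k + 1) * star (Z X (k + 1))) ≤ 1 := by
        have h := (hle k).mul_mul_conjTranspose_same (R X (k + 1))⁻¹
        rw [Matrix.conjTranspose_nonsing_inv, hRh, Matrix.mul_sub, Matrix.sub_mul, ← hRR (k + 1),
          Matrix.nonsing_inv_mul_cancel_left _ _ hu, Matrix.mul_nonsing_inv _ hu,
          Matrix.mul_smul, Matrix.smul_mul, ← hZ] at h
        exact h
      have hn := (CStarAlgebra.norm_le_one_iff_of_nonneg _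
        (smul_nonneg hr.le (mul_star_self_nonneg _))).2 hle1
      rw [norm_smul, Real.norm_of_nonneg hr.le] at hn
      rwa [le_div_iff₀ hr, mul_comm]
  have h1 : max 1 (1 / r) ≤ 1 + 1 / r :=
    max_le (le_add_of_nonneg_right (by positivity)) (le_add_of_nonneg_left zero_le_one)
  have h2 : (1 : ℝ) ≤ 1 + 1 / r := le_add_of_nonneg_right (by positivity)
  nlinarith [norm_nonneg (Z X k)]

end Weights

/-! ### The Fock space and the weighted shifts -/

section Fock

/-- The full Fock space `⊕_{k ≥ 0} (ℂ^d)^{⊗k}` (Hilbert space direct sum). -/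
abbrev Fock (d : ℕ) : Type := lp (fun k : ℕ => TensorPow d k) 2

/-- `L_i θ = e_i ⊗ θ`. -/
noncomputable def creation {d : ℕ} (i : Fin d) (k : ℕ) : TensorPow d k →ₗ[ℂ] TensorPow d (k + 1) where
  toFun θ := WithLp.toLp 2 fun α => if α 0 = i then θ (Fin.tail α) else 0
  map_add' θ η := by
    ext α
    by_cases h : α 0 = i <;> simp [h]
  map_smul' c θ := by
    ext α
    by_cases h : α 0 = i <;> simp [h]

theorem norm_creation {d : ℕ} (i : Fin d) (k : ℕ) (θ : TensorPow d k) :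
    ‖creation i k θ‖ = ‖θ‖ := by
  rw [EuclideanSpace.norm_eq, EuclideanSpace.norm_eq]
  congr 1
  rw [← (Fin.consEquiv (fun _ : Fin (k + 1) => Fin d)).sum_comp, Fintype.sum_prod_type,
    Fintype.sum_eq_single i]
  · simp [creation, Fin.consEquiv]
  · intro j hj
    simp [creation, Fin.consEquiv, hj]

/-- The components of `W̃_i f`: for `θ` of degree `k`, `W̃_i θ = Z_{k+1} (e_i ⊗ θ)`. -/
noncomputable def shiftFun {d : ℕ} (X : ∀ k : ℕ, WordMatrix d k) (i : Fin d)
    (f : ∀ k : ℕ, TensorPow d k) : ∀ k : ℕ, TensorPow d k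
  | 0 => 0
  | k + 1 => Matrix.toEuclideanCLM (𝕜 := ℂ) (Z X (k + 1)) (creation i k (f k))

theorem shiftFun_bound {d : ℕ} {X : ∀ k : ℕ, WordMatrix d k} (hX : IsAdmissible X) (i : Fin d) :
    ∃ C : ℝ, 0 ≤ C ∧ ∀ f : Fock d, ∀ s : Finset ℕ,
      ∑ k ∈ s, ‖shiftFun X i f k‖ ^ (2 : ℝ≥0∞).toReal ≤ (C * ‖f‖) ^ (2 : ℝ≥0∞).toReal := by
  obtain ⟨C, hC⟩ := exists_norm_Z_le hX
  have hC0 : 0 ≤ C := (norm_nonneg _).trans (hC 0)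
  refine ⟨C, hC0, fun f s => ?_⟩
  simp only [ENNReal.toReal_ofNat, Real.rpow_ofNat]
  have hk : ∀ k, ‖shiftFun X i f (k + 1)‖ ^ 2 ≤ C ^ 2 * ‖f k‖ ^ 2 := by
    intro k
    rw [← mul_pow]
    refine pow_le_pow_left₀ (norm_nonneg _) ?_ 2
    refine (ContinuousLinearMap.le_of_opNorm_le _ (hC (k + 1)) _).trans_eq ?_
    rw [norm_creation]
  obtain ⟨N, hN⟩ := s.exists_nat_subset_range
  calc ∑ k ∈ s, ‖shiftFun X i f k‖ ^ 2
      ≤ ∑ k ∈ Finset.range (N + 1), ‖shiftFun X i f k‖ ^ 2 :=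
        Finset.sum_le_sum_of_subset_of_nonneg
          (hN.trans (Finset.range_mono (Nat.le_succ N))) fun _ _ _ => sq_nonneg _
    _ = ∑ k ∈ Finset.range N, ‖shiftFun X i f (k + 1)‖ ^ 2 := by
        rw [Finset.sum_range_succ']
        simp [shiftFun]
    _ ≤ ∑ k ∈ Finset.range N, C ^ 2 * ‖f k‖ ^ 2 := Finset.sum_le_sum fun k _ => hk k
    _ = C ^ 2 * ∑ k ∈ Finset.range N, ‖f k‖ ^ 2 := by rw [Finset.mul_sum]
    _ ≤ C ^ 2 * ‖f‖ ^ 2 := by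
        refine mul_le_mul_of_nonneg_left ?_ (sq_nonneg C)
        have := lp.sum_rpow_le_norm_rpow (p := 2) (by norm_num) f (Finset.range N)
        simpa using this
    _ = (C * ‖f‖) ^ 2 := (mul_pow _ _ _).symm

/-- The weighted shift `W̃_i` on the full Fock space: `W̃_i θ = Z_{k+1} (e_i ⊗ θ)` for
`θ ∈ (ℂ^d)^{⊗k}`. -/
noncomputable def fockShift {d : ℕ} {X : ∀ k : ℕ, WordMatrix d k} (hX : IsAdmissible X)
    (i : Fin d) : Fock d →L[ℂ] Fock d :=
  LinearMap.mkContinuousOfExistsBound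
    { toFun := fun f => ⟨shiftFun X i f, by
        obtain ⟨C, -, h⟩ := shiftFun_bound hX i
        exact memℓp_gen' (h f)⟩
      map_add' := fun f g => by
        ext1
        funext k
        cases k with
        | zero => exact (add_zero (0 : TensorPow d 0)).symm
        | succ k =>
          exact (congrArg _ (map_add (creation i k) (f k) (g k))).trans (map_add _ _ _)
      map_smul' := fun c f => by
        ext1
        funext k
        cases k with
        | zero => exact (smul_zero (A := TensorPow d 0) c).symm
        | succ k => simp [shiftFun] }
    (by
      obtain ⟨C, hC, h⟩ := shiftFun_bound hX i
      exact ⟨C, fun f =>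
        lp.norm_le_of_forall_sum_le (by norm_num) (mul_nonneg hC (norm_nonneg f)) (h f)⟩)

/-- The symmetric tensors in `(ℂ^d)^{⊗k}`. -/
def symTensors (d k : ℕ) : Submodule ℂ (TensorPow d k) where
  carrier := {ξ | ∀ (σ : Equiv.Perm (Fin k)) (α : Fin k → Fin d), ξ (α ∘ σ) = ξ α}
  zero_mem' := fun _ _ => rfl
  add_mem' := fun {ξ η} hξ hη σ α => by
    rw [PiLp.add_apply, PiLp.add_apply, hξ σ α, hη σ α]
  smul_mem' := fun c ξ hξ σ α => by
    rw [PiLp.smul_apply, PiLp.smul_apply, hξ σ α]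

/-- `𝓡_k^0 = R_k (symmetric tensors) ⊆ (ℂ^d)^{⊗k}`. -/
noncomputable def RSym {d : ℕ} (X : ∀ k : ℕ, WordMatrix d k) (k : ℕ) :
    Submodule ℂ (TensorPow d k) :=
  (symTensors d k).map (Matrix.toEuclideanCLM (𝕜 := ℂ) (R X k) : TensorPow d k →ₗ[ℂ] TensorPow d k)

/-- The weighted Drury–Arveson space `𝓕(𝓡) = ⊕_{k ≥ 0} 𝓡_k^0`, as a subspace of the Fock space. -/
noncomputable def weightedDA {d : ℕ} (X : ∀ k : ℕ, WordMatrix d k) : Submodule ℂ (Fock d) where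
  carrier := {f | ∀ k, f k ∈ RSym X k}
  zero_mem' := fun k => (RSym X k).zero_mem
  add_mem' := fun hf hg k => (RSym X k).add_mem (hf k) (hg k)
  smul_mem' := fun c _ hf k => (RSym X k).smul_mem c (hf k)

theorem isClosed_weightedDA {d : ℕ} (X : ∀ k : ℕ, WordMatrix d k) :
    IsClosed (weightedDA X : Set (Fock d)) := by
  have : (weightedDA X : Set (Fock d)) = ⋂ k, (fun f : Fock d => f k) ⁻¹' (RSym X k) := by
    ext f
    exact (Set.mem_iInter (x := f) (s := fun k => (fun f : Fock d => f k) ⁻¹' (RSym X k))).symm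
  rw [this]
  exact isClosed_iInter fun k => (Submodule.closed_of_finiteDimensional (RSym X k)).preimage
    (lp.lipschitzWith_one_eval 2 k).continuous

noncomputable instance {d : ℕ} (X : ∀ k : ℕ, WordMatrix d k) : CompleteSpace (weightedDA X) :=
  (isClosed_weightedDA X).completeSpace_coe

/-- The weighted shift `W_i`, the compression of `W̃_i` to `𝓕(𝓡)`. -/
noncomputable def weightedShift {d : ℕ} {X : ∀ k : ℕ, WordMatrix d k} (hX : IsAdmissible X)
    (i : Fin d) : weightedDA X →L[ℂ] weightedDA X :=
  (weightedDA X).orthogonalProjectionOnto ∘L fockShift hX i ∘L (weightedDA X).subtypeL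

end Fock

/-! ### Tuples of operators -/

section Tuples

variable {H : Type*} [NormedAddCommGroup H] [InnerProductSpace ℂ H] [CompleteSpace H]

/-- `T_α = T_{α(1)} ⋯ T_{α(k)}`. -/
noncomputable def wordProd {d k : ℕ} (T : Fin d → H →L[ℂ] H) (α : Fin k → Fin d) : H →L[ℂ] H :=
  (List.ofFn fun j => T (α j)).prod

/-- `T^{(k)} (X_k ⊗ a) T^{(k)*} = ∑_{|α| = |β| = k} x_{α,β} T_α a T_β^*`. -/
noncomputable def phiTerm {d : ℕ} (X : ∀ k : ℕ, WordMatrix d k) (T : Fin d → H →L[ℂ] H) (k : ℕ)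
    (a : H →L[ℂ] H) : H →L[ℂ] H :=
  ∑ α : Fin k → Fin d, ∑ β : Fin k → Fin d,
    X k α β • (wordProd T α ∘L a ∘L ContinuousLinearMap.adjoint (wordProd T β))

/-- Convergence of `∑_{k ≥ 1} T^{(k)} (X_k ⊗ I) T^{(k)*}`, a series of positive operators. For such a
series convergence in the weak operator topology, in the strong operator topology and in the
weak-* topology of `B(H)` are the same. -/
def PhiConverges {d : ℕ} (X : ∀ k : ℕ, WordMatrix d k) (T : Fin d → H →L[ℂ] H) : Prop :=
  Summable fun k : ℕ => (ContinuousLinearMapWOT.ofCLM (phiTerm X T (k + 1) 1) : H →WOT[ℂ] H)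

/-- `Φ_T(a) = ∑_{k ≥ 1} T^{(k)} (X_k ⊗ a) T^{(k)*}`, the sum taken in the weak operator topology
(it exists for every `a` as soon as it exists for `a = I`). -/
noncomputable def Phi {d : ℕ} (X : ∀ k : ℕ, WordMatrix d k) (T : Fin d → H →L[ℂ] H)
    (a : H →L[ℂ] H) : H →L[ℂ] H :=
  (∑' k : ℕ, (ContinuousLinearMapWOT.ofCLM (phiTerm X T (k + 1) a) : H →WOT[ℂ] H)).toCLM

/-- `T` is pure if `Φ_T^m(I)` decreases to `0` strongly. -/
def IsPure {d : ℕ} (X : ∀ k : ℕ, WordMatrix d k) (T : Fin d → H →L[ℂ] H) : Prop :=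
  Antitone (fun m : ℕ => (Phi X T)^[m] 1) ∧
    ∀ h : H, Filter.Tendsto (fun m : ℕ => (Phi X T)^[m] 1 h) Filter.atTop (nhds 0)

/-- The class `D̄_{cp}(X, H)` of commuting tuples `T` of operators on `H` for which `Φ_T` is defined,
`‖Φ_T(I)‖ ≤ 1`, and which are pure. -/
structure IsPureContractive {d : ℕ} (X : ∀ k : ℕ, WordMatrix d k) (T : Fin d → H →L[ℂ] H) :
    Prop where
  commute : ∀ i j, T i ∘L T j = T j ∘L T i
  converges : PhiConverges X T
  norm_le_one : ‖Phi X T 1‖ ≤ 1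
  pure : IsPure X T

/-- `V` is a partial isometry: it is isometric on the orthogonal complement of its kernel. -/
def IsPartialIsometry {K : Type*} [NormedAddCommGroup K] [InnerProductSpace ℂ K]
    (V : K →L[ℂ] H) : Prop :=
  ∀ x ∈ (LinearMap.ker (V : K →ₗ[ℂ] H))ᗮ, ‖V x‖ = ‖x‖

end Tuples

/-! ### Hilbert space tensor products -/

section HilbertTensor

/-- The Hilbert space tensor product: the completion of the algebraic tensor product for the inner
product `⟪x ⊗ y, x' ⊗ y'⟫ = ⟪x, x'⟫ ⟪y, y'⟫`. -/
abbrev HilbertTensor (F D : Type*) [NormedAddCommGroup F] [InnerProductSpace ℂ F]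
    [NormedAddCommGroup D] [InnerProductSpace ℂ D] : Type _ :=
  UniformSpace.Completion (F ⊗[ℂ] D)

/-- `A ⊗ I_D` on the Hilbert space tensor product. -/
noncomputable def tensorId {F : Type*} [NormedAddCommGroup F] [InnerProductSpace ℂ F]
    (D : Type*) [NormedAddCommGroup D] [InnerProductSpace ℂ D] (A : F →L[ℂ] F) :
    HilbertTensor F D →L[ℂ] HilbertTensor F D :=
  (TensorProduct.mapL A (ContinuousLinearMap.id ℂ D)).completion

end HilbertTensor

end WeightedDruryArveson

universe u

/-! If S = ran Π and Π intertwines, invariance is immediate. For the converse, write P for the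
projection onto S and Φ for Φ_T. Each T_α^* maps S^⊥ into itself, so Φ(P) = PΦ(P)P ≤ PΦ(I)P ≤ P
(`Phi_starProjection_le`), and P - Φ(P) = b^*b for some b.

Since R_n² sums over the compositions of n, formally ∑_n T^{(n)}(R_n² ⊗ a)T^{(n)*} = ∑_m Φ^m(a). At
a = P - Φ(P) this telescopes to P - lim Φ^m(P), and purity kills the limit. The rigorous form is
`eq_of_tendsto_sum_sandwich_RSq`: a renewal equation in the first part of a composition bounds the
partial sums by P, and their limit S' satisfies P - S' ≤ Φ(P - S'), which purity forces to vanish.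

Hence the Poisson kernel Gv = ((R_k ⊗ b)(T_β^* v)_β)_k satisfies G^*G = P (`exists_poissonKernel`).
As the T_i commute, T_β^* v is symmetric in β, so G takes values in 𝓕(𝓡) ⊗ H. There G^* sends f ⊗ y
to ∑_k (R_k f_k)(T) b^*y, where ξ(T) = ∑_β ξ_β T_β. The identity R_{k+1}Z_{k+1} = I ⊗ R_k makes this
map intertwine W_i ⊗ I with T_i; the compression to 𝓕(𝓡) is harmless because ξ ↦ ξ(T) sees only the
symmetric part of ξ. So Π = G^* restricted to 𝓕(𝓡) ⊗ H satisfies ΠΠ^* = P, and is a partial isometry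
onto S. -/

namespace WeightedDruryArveson

open scoped ENNReal TensorProduct InnerProductSpace ComplexOrder Matrix
open Filter Topology

/-! ### Operator order through quadratic forms. -/

section OperatorOrder

variable {H : Type*} [NormedAddCommGroup H] [InnerProductSpace ℂ H]

/-- In the order of ℂ a nonnegative number is real, and over ℂ a real quadratic form makes the
operator self-adjoint. Operator inequalities can thus be summed and passed to weak limits as scalar
ones. -/
theorem clm_le_iff_inner_le (a b : H →L[ℂ] H) : a ≤ b ↔ ∀ x, ⟪x, a x⟫_ℂ ≤ ⟪x, b x⟫_ℂ := by
  rw [ContinuousLinearMap.le_def]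
  constructor
  · intro h x
    have := h.inner_nonneg_right x
    rwa [sub_apply, inner_sub_right, sub_nonneg] at this
  · intro h
    rw [ContinuousLinearMap.isPositive_iff_complex]
    intro x
    have h1 : 0 ≤ ⟪x, (b - a) x⟫_ℂ := by
      rw [sub_apply, inner_sub_right, sub_nonneg]
      exact h x
    obtain ⟨hr, hi⟩ := Complex.nonneg_iff.1 h1
    rw [← inner_conj_symm]
    exact ⟨Complex.ext (by simp) (by rw [Complex.conj_im, ← hi]; simp), by rw [RCLike.conj_re]; exact hr⟩

theorem inner_nonneg_of_nonneg {a : H →L[ℂ] H} (ha : 0 ≤ a) (x : H) : 0 ≤ ⟪x, a x⟫_ℂ := by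
  simpa using (clm_le_iff_inner_le 0 a).1 ha x

end OperatorOrder

/-! ### Column operators into an ℓ² sum of copies of H. -/

section Column

variable {H : Type*} [NormedAddCommGroup H] [InnerProductSpace ℂ H]

/-- The `ℓ²` direct sum of copies of `H` indexed by a family of finite types. -/
abbrev ColumnSpace (ι : ℕ → Type) [∀ k, Fintype (ι k)] (H : Type*) [NormedAddCommGroup H] :
    Type _ :=
  lp (fun k : ℕ => PiLp 2 (fun _ : ι k => H)) 2

/-- A square-summable family of operators defines a bounded operator into the `ℓ²` direct sum. -/
theorem exists_column {ι : ℕ → Type} [∀ k, Fintype (ι k)] (g : ∀ k, ι k → H →L[ℂ] H) (C : ℝ)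
    (hC : ∀ v (s : Finset ℕ), ∑ k ∈ s, ∑ γ, ‖g k γ v‖ ^ 2 ≤ C * ‖v‖ ^ 2) :
    ∃ G : H →L[ℂ] ColumnSpace ι H, ∀ v k γ, G v k γ = g k γ v := by
  -- The constant `C` may be negative when `H` is trivial, hence `max C 0` under the root.
  have hb : ∀ (v : H) (s : Finset ℕ), ∑ k ∈ s,
      ‖(WithLp.toLp 2 fun γ => g k γ v : PiLp 2 (fun _ : ι k => H))‖ ^ (2 : ℝ≥0∞).toReal ≤
        (Real.sqrt (max C 0) * ‖v‖) ^ (2 : ℝ≥0∞).toReal := by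
    intro v s
    simp only [ENNReal.toReal_ofNat, Real.rpow_ofNat, mul_pow]
    rw [Real.sq_sqrt (le_max_right _ _)]
    refine le_trans (le_of_eq ?_) ((hC v s).trans
      (mul_le_mul_of_nonneg_right (le_max_left _ _) (sq_nonneg _)))
    exact Finset.sum_congr rfl fun k _ => by rw [PiLp.norm_sq_eq_of_L2]
  refine ⟨LinearMap.mkContinuous
    { toFun := fun v => ⟨fun k => WithLp.toLp 2 fun γ => g k γ v, memℓp_gen' (hb v)⟩
      map_add' := fun v w => by
        ext1; funext k; ext γ; exact map_add (g k γ) v w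
      map_smul' := fun c v => by
        ext1; funext k; ext γ; exact map_smul (g k γ) c v } (Real.sqrt (max C 0))
      fun v => lp.norm_le_of_forall_sum_le (by norm_num)
        (mul_nonneg (Real.sqrt_nonneg _) (norm_nonneg v)) (hb v), fun v k γ => rfl⟩

theorem column_hasSum_inner {ι : ℕ → Type} [∀ k, Fintype (ι k)] (f f' : ColumnSpace ι H) :
    HasSum (fun k => ∑ γ, ⟪f k γ, f' k γ⟫_ℂ) ⟪f, f'⟫_ℂ := by
  have := lp.hasSum_inner (𝕜 := ℂ) f f'
  simpa only [PiLp.inner_apply] using this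

end Column

/-! ### The completely positive maps a ↦ T^{(k)} (M ⊗ a) T^{(k)*}. -/

section Sandwich

variable {H : Type*} [NormedAddCommGroup H] [InnerProductSpace ℂ H] [CompleteSpace H]

/-- `∑_{|α| = |β| = k} m_{α,β} T_α a T_β^*`. -/
noncomputable def sandwich {d k : ℕ} (T : Fin d → H →L[ℂ] H) (M : WordMatrix d k)
    (a : H →L[ℂ] H) : H →L[ℂ] H :=
  ∑ α : Fin k → Fin d, ∑ β : Fin k → Fin d,
    M α β • (wordProd T α ∘L a ∘L ContinuousLinearMap.adjoint (wordProd T β))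

/-- `∑_β b_{γ,β} T_β^*`. -/
noncomputable def krausOp {d k : ℕ} (T : Fin d → H →L[ℂ] H) (B : WordMatrix d k)
    (γ : Fin k → Fin d) : H →L[ℂ] H :=
  ∑ β : Fin k → Fin d, B γ β • ContinuousLinearMap.adjoint (wordProd T β)

theorem adjoint_krausOp {d k : ℕ} (T : Fin d → H →L[ℂ] H) (B : WordMatrix d k)
    (γ : Fin k → Fin d) :
    ContinuousLinearMap.adjoint (krausOp T B γ) =
      ∑ β : Fin k → Fin d, star (B γ β) • wordProd T β := by
  rw [krausOp, map_sum]
  refine Finset.sum_congr rfl fun β _ => ?_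
  rw [LinearIsometryEquiv.map_smulₛₗ, ContinuousLinearMap.adjoint_adjoint]
  rfl

/-- Factoring the coefficient matrix gives a Kraus form. Positivity, monotonicity and all square-sum
estimates come from it. -/
theorem sandwich_eq_sum_kraus {d k : ℕ} (T : Fin d → H →L[ℂ] H) (B : WordMatrix d k)
    (a : H →L[ℂ] H) :
    sandwich T (Bᴴ * B) a =
      ∑ γ, ContinuousLinearMap.adjoint (krausOp T B γ) ∘L a ∘L krausOp T B γ := by
  have : ∀ γ, ContinuousLinearMap.adjoint (krausOp T B γ) ∘L a ∘L krausOp T B γ =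
      ∑ α, ∑ β, (star (B γ α) * B γ β) •
        (wordProd T α ∘L a ∘L ContinuousLinearMap.adjoint (wordProd T β)) := by
    intro γ
    rw [adjoint_krausOp]
    ext v
    simp only [krausOp, ContinuousLinearMap.comp_apply, sum_apply,
      smul_apply, map_sum, map_smul, Finset.smul_sum, mul_smul]
    rw [Finset.sum_comm]
    exact Finset.sum_congr rfl fun α _ => Finset.sum_congr rfl fun β _ => smul_comm _ _ _
  simp only [this]
  rw [Finset.sum_comm, sandwich]
  refine Finset.sum_congr rfl fun α _ => ?_
  rw [Finset.sum_comm]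
  refine Finset.sum_congr rfl fun β _ => ?_
  rw [← Finset.sum_smul, Matrix.mul_apply]
  rfl

theorem inner_sandwich {d k : ℕ} (T : Fin d → H →L[ℂ] H) (B : WordMatrix d k)
    (a : H →L[ℂ] H) (u v : H) :
    ⟪u, sandwich T (Bᴴ * B) a v⟫_ℂ = ∑ γ, ⟪krausOp T B γ u, a (krausOp T B γ v)⟫_ℂ := by
  rw [sandwich_eq_sum_kraus, sum_apply, inner_sum]
  refine Finset.sum_congr rfl fun γ _ => ?_
  rw [ContinuousLinearMap.comp_apply, ContinuousLinearMap.adjoint_inner_right]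
  rfl

open scoped MatrixOrder in
theorem exists_conjTranspose_mul_self {d k : ℕ} {M : WordMatrix d k} (hM : M.PosSemidef) :
    ∃ B : WordMatrix d k, M = Bᴴ * B := by
  classical
  obtain ⟨B, hB⟩ := CStarAlgebra.nonneg_iff_eq_star_mul_self.1 (show 0 ≤ M from hM.nonneg)
  exact ⟨B, hB⟩

theorem sandwich_mono {d k : ℕ} (T : Fin d → H →L[ℂ] H) {M : WordMatrix d k} (hM : M.PosSemidef)
    {a b : H →L[ℂ] H} (hab : a ≤ b) : sandwich T M a ≤ sandwich T M b := by
  obtain ⟨B, rfl⟩ := exists_conjTranspose_mul_self hM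
  rw [clm_le_iff_inner_le] at hab ⊢
  intro x
  rw [inner_sandwich, inner_sandwich]
  exact Finset.sum_le_sum fun γ _ => hab _

theorem sandwich_zero {d k : ℕ} (T : Fin d → H →L[ℂ] H) (M : WordMatrix d k) :
    sandwich T M 0 = 0 := by
  simp [sandwich]

theorem sandwich_sub {d k : ℕ} (T : Fin d → H →L[ℂ] H) (M : WordMatrix d k) (a b : H →L[ℂ] H) :
    sandwich T M (a - b) = sandwich T M a - sandwich T M b := by
  simp [sandwich, smul_sub, Finset.sum_sub_distrib]

theorem sandwich_sum {d k : ℕ} (T : Fin d → H →L[ℂ] H) (M : WordMatrix d k) {ι : Type*}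
    (s : Finset ι) (a : ι → H →L[ℂ] H) :
    sandwich T M (∑ i ∈ s, a i) = ∑ i ∈ s, sandwich T M (a i) := by
  classical
  induction s using Finset.induction_on with
  | empty => simp [sandwich_zero]
  | insert i s hi ih =>
    rw [Finset.sum_insert hi, Finset.sum_insert hi, ← ih]
    simp [sandwich, Finset.sum_add_distrib]

theorem sandwich_nonneg {d k : ℕ} (T : Fin d → H →L[ℂ] H) {M : WordMatrix d k}
    (hM : M.PosSemidef) {a : H →L[ℂ] H} (ha : 0 ≤ a) : 0 ≤ sandwich T M a := by
  simpa [sandwich_zero] using sandwich_mono T hM ha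

theorem inner_sandwich_eq_sum {d k : ℕ} (T : Fin d → H →L[ℂ] H) (M : WordMatrix d k)
    (a : H →L[ℂ] H) (u v : H) :
    ⟪u, sandwich T M a v⟫_ℂ = ∑ α, ∑ β, M α β *
      ⟪ContinuousLinearMap.adjoint (wordProd T α) u,
        a (ContinuousLinearMap.adjoint (wordProd T β) v)⟫_ℂ := by
  simp only [sandwich, sum_apply, inner_sum, smul_apply, inner_smul_right,
    ContinuousLinearMap.comp_apply, ContinuousLinearMap.adjoint_inner_left]

/-- `sandwich T M` is continuous for the weak operator topology. -/
theorem sandwich_tendsto_inner {d k : ℕ} (T : Fin d → H →L[ℂ] H) (M : WordMatrix d k)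
    {a : ℕ → H →L[ℂ] H} {b : H →L[ℂ] H}
    (hab : ∀ u v, Tendsto (fun n => ⟪u, a n v⟫_ℂ) atTop (𝓝 ⟪u, b v⟫_ℂ)) (u v : H) :
    Tendsto (fun n => ⟪u, sandwich T M (a n) v⟫_ℂ) atTop (𝓝 ⟪u, sandwich T M b v⟫_ℂ) := by
  simp only [inner_sandwich_eq_sum]
  exact tendsto_finsetSum _ fun α _ => tendsto_finsetSum _ fun β _ => (hab _ _).const_mul _

end Sandwich

/-! ### Convergence, monotonicity and additivity of Φ_T. -/

section PhiMap

variable {H : Type*} [NormedAddCommGroup H] [InnerProductSpace ℂ H] [CompleteSpace H]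
  {d : ℕ} {X : ∀ k : ℕ, WordMatrix d k} {T : Fin d → H →L[ℂ] H}

theorem Phi_hasSum_of_summable {a : H →L[ℂ] H}
    (h : Summable fun k : ℕ =>
      (ContinuousLinearMapWOT.ofCLM (phiTerm X T (k + 1) a) : H →WOT[ℂ] H)) (u v : H) :
    HasSum (fun k => ⟪u, phiTerm X T (k + 1) a v⟫_ℂ) ⟪u, Phi X T a v⟫_ℂ := by
  have h1 := (ContinuousLinearMapWOT.tendsto_iff_forall_inner_apply_tendsto).1 h.hasSum v u
  refine (tendsto_congr fun s => ?_).1 h1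
  rw [← inner_sum]
  congr 1
  have : ∀ s : Finset ℕ, (∑ b ∈ s,
      (ContinuousLinearMapWOT.ofCLM (phiTerm X T (b + 1) a) : H →WOT[ℂ] H)) v =
      ∑ b ∈ s, phiTerm X T (b + 1) a v := by
    intro s
    classical
    induction s using Finset.induction_on with
    | empty => simp
    | insert i s hi ih => rw [Finset.sum_insert hi, Finset.sum_insert hi, ← ih]; rfl
  exact this s

/-- Weak operator convergence is tested on inner products, provided that the limit form comes from a
bounded operator; here it is `b`. -/
theorem summable_of_inner_hasSum {a b : H →L[ℂ] H}
    (h : ∀ u v, HasSum (fun k => ⟪u, phiTerm X T (k + 1) a v⟫_ℂ) ⟪u, b v⟫_ℂ) :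
    Summable fun k : ℕ =>
      (ContinuousLinearMapWOT.ofCLM (phiTerm X T (k + 1) a) : H →WOT[ℂ] H) := by
  refine ⟨ContinuousLinearMapWOT.ofCLM b,
    (ContinuousLinearMapWOT.tendsto_iff_forall_inner_apply_tendsto).2 fun v u => ?_⟩
  refine (tendsto_congr fun s => ?_).1 (h u v)
  rw [← inner_sum]
  congr 1
  classical
  induction s using Finset.induction_on with
  | empty => simp
  | insert i s hi ih => rw [Finset.sum_insert hi, Finset.sum_insert hi, ih]; rfl

theorem phiTerm_nonneg (hX : IsAdmissible X) (k : ℕ) {a : H →L[ℂ] H} (ha : 0 ≤ a) :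
    0 ≤ phiTerm X T (k + 1) a :=
  -- By definition `phiTerm X T k` is `sandwich T (X k)`.
  sandwich_nonneg T (hX.posSemidef _ (Nat.le_add_left 1 k)) ha

/-- Once `Φ_T(I)` converges, `Φ_T(a)` converges for every `a`. -/
theorem Phi_hasSum (hX : IsAdmissible X) (hT : PhiConverges X T) (a : H →L[ℂ] H) (u v : H) :
    HasSum (fun k => ⟪u, phiTerm X T (k + 1) a v⟫_ℂ) ⟪u, Phi X T a v⟫_ℂ := by
  choose B hB using fun k : ℕ =>
    exists_conjTranspose_mul_self (hX.posSemidef (k + 1) (Nat.le_add_left 1 k))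
  have hterm : ∀ k (c : H →L[ℂ] H) (u v : H), ⟪u, phiTerm X T (k + 1) c v⟫_ℂ =
      ∑ γ, ⟪krausOp T (B k) γ u, c (krausOp T (B k) γ v)⟫_ℂ := by
    intro k c u v
    rw [← inner_sandwich, ← hB]
    rfl
  -- Convergence at I says exactly that the Kraus operators form a square-summable column.
  have hbd : ∀ (v : H) (s : Finset ℕ), ∑ k ∈ s, ∑ γ, ‖krausOp T (B k) γ v‖ ^ 2 ≤
      ‖Phi X T 1‖ * ‖v‖ ^ 2 := by
    intro v s
    have h1 := (Phi_hasSum_of_summable hT v v)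
    have h2 := sum_le_hasSum s (fun k _ =>
      inner_nonneg_of_nonneg (phiTerm_nonneg hX k zero_le_one) v) h1
    have h3 : ∀ k, ⟪v, phiTerm X T (k + 1) 1 v⟫_ℂ =
        ((∑ γ, ‖krausOp T (B k) γ v‖ ^ 2 : ℝ) : ℂ) := by
      intro k
      rw [hterm]
      push_cast
      exact Finset.sum_congr rfl fun γ _ => inner_self_eq_norm_sq_to_K (𝕜 := ℂ) _
    simp only [h3] at h2
    rw [← Complex.ofReal_sum] at h2
    have h4 := (Complex.le_def.1 h2).1
    rw [Complex.ofReal_re] at h4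
    refine h4.trans ((Complex.re_le_norm _).trans ((norm_inner_le_norm _ _).trans ?_))
    rw [sq, mul_left_comm]
    exact mul_le_mul_of_nonneg_left (ContinuousLinearMap.le_opNorm _ _) (norm_nonneg _)
  obtain ⟨G, hG⟩ := exists_column (ι := fun k => Fin (k + 1) → Fin d)
    (fun k γ => krausOp T (B k) γ) _ hbd
  obtain ⟨G', hG'⟩ := exists_column (ι := fun k => Fin (k + 1) → Fin d)
    (fun k γ => a ∘L krausOp T (B k) γ) (‖a‖ ^ 2 * ‖Phi X T 1‖) (by
      intro v s
      rw [mul_assoc]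
      refine le_trans ?_ (mul_le_mul_of_nonneg_left (hbd v s) (sq_nonneg _))
      rw [Finset.mul_sum]
      refine Finset.sum_le_sum fun k _ => ?_
      rw [Finset.mul_sum]
      refine Finset.sum_le_sum fun γ _ => ?_
      rw [← mul_pow]
      exact pow_le_pow_left₀ (norm_nonneg _) (a.le_opNorm _) 2)
  -- With K_{k,γ} the Kraus operators, the columns G = (K_{k,γ}) and G' = (a K_{k,γ}) are bounded,
  -- and G^*G' is the weak sum.
  refine Phi_hasSum_of_summable
    (summable_of_inner_hasSum (b := ContinuousLinearMap.adjoint G ∘L G') fun u v => ?_) u v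
  rw [ContinuousLinearMap.comp_apply, ContinuousLinearMap.adjoint_inner_right]
  convert column_hasSum_inner (G u) (G' v) using 2 with k
  rw [hterm]
  simp only [hG, hG', ContinuousLinearMap.comp_apply]

theorem Phi_mono (hX : IsAdmissible X) (hT : PhiConverges X T) {a b : H →L[ℂ] H} (hab : a ≤ b) :
    Phi X T a ≤ Phi X T b := by
  rw [clm_le_iff_inner_le]
  refine fun x => hasSum_le (fun k => ?_) (Phi_hasSum hX hT a x x) (Phi_hasSum hX hT b x x)
  exact (clm_le_iff_inner_le _ _).1
    (sandwich_mono T (hX.posSemidef _ (Nat.le_add_left 1 k)) hab) x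

theorem Phi_sub (hX : IsAdmissible X) (hT : PhiConverges X T) (a b : H →L[ℂ] H) :
    Phi X T (a - b) = Phi X T a - Phi X T b := by
  ext v
  refine ext_inner_left ℂ fun u => (Phi_hasSum hX hT (a - b) u v).unique ?_
  rw [sub_apply, inner_sub_right]
  have h : (fun k => ⟪u, phiTerm X T (k + 1) (a - b) v⟫_ℂ) = fun k =>
      ⟪u, phiTerm X T (k + 1) a v⟫_ℂ - ⟪u, phiTerm X T (k + 1) b v⟫_ℂ := by
    funext k
    rw [← inner_sub_right, ← sub_apply]
    exact congrArg (fun c : H →L[ℂ] H => ⟪u, c v⟫_ℂ) (sandwich_sub T (X (k + 1)) a b)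
  rw [h]
  exact (Phi_hasSum hX hT a u v).sub (Phi_hasSum hX hT b u v)

theorem sum_phiTerm_le_Phi (hX : IsAdmissible X) (hT : PhiConverges X T) {a : H →L[ℂ] H}
    (ha : 0 ≤ a) (n : ℕ) : ∑ k ∈ Finset.range n, phiTerm X T (k + 1) a ≤ Phi X T a := by
  rw [clm_le_iff_inner_le]
  intro x
  rw [sum_apply, inner_sum]
  exact sum_le_hasSum _ (fun k _ => inner_nonneg_of_nonneg (phiTerm_nonneg hX k ha) x)
    (Phi_hasSum hX hT a x x)

theorem Phi_le_of_sum_phiTerm_le (hX : IsAdmissible X) (hT : PhiConverges X T)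
    {a b : H →L[ℂ] H} (h : ∀ n, ∑ k ∈ Finset.range n, phiTerm X T (k + 1) a ≤ b) :
    Phi X T a ≤ b := by
  rw [clm_le_iff_inner_le]
  refine fun x => le_of_tendsto (Phi_hasSum hX hT a x x).tendsto_sum_nat
    (Eventually.of_forall fun n => ?_)
  have := (clm_le_iff_inner_le _ _).1 (h n) x
  rwa [sum_apply, inner_sum] at this

end PhiMap

/-! ### Splitting off the first part of a composition. -/

section Compositions

/-- Prepending a positive part to a composition. -/
def consPart (b : ℕ) (hb : 0 < b) {m : ℕ} (c : Composition m) : Composition (b + m) where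
  blocks := b :: c.blocks
  blocks_pos := by
    intro i hi
    rcases List.mem_cons.1 hi with rfl | h
    · exact hb
    · exact c.blocks_pos h
  blocks_sum := by rw [List.sum_cons, c.blocks_sum]

theorem tensorBlocks_consPart {d : ℕ} (X : ∀ k : ℕ, WordMatrix d k) (b : ℕ) (hb : 0 < b) {m : ℕ}
    (c : Composition m) (α β : Fin b → Fin d) (α' β' : Fin m → Fin d) :
    tensorBlocks X (consPart b hb c) (Fin.append α α') (Fin.append β β') =
      X b α β * tensorBlocks X c α' β' := by
  have h0 : ∀ (γ : Fin b → Fin d) (γ' : Fin m → Fin d),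
      (Fin.append γ γ' ∘ (consPart b hb c).embedding (0 : Fin (c.length + 1)) : Fin b → Fin d) =
        γ := by
    intro γ γ'
    funext j
    have : (consPart b hb c).embedding (0 : Fin (c.length + 1)) j = Fin.castAdd m j := by
      refine Fin.ext ?_
      change (consPart b hb c).sizeUpTo 0 + (j : ℕ) = j
      rw [Composition.sizeUpTo_zero, Nat.zero_add]
    exact (congrArg (Fin.append γ γ') this).trans (Fin.append_left γ γ' j)
  have hs : ∀ (γ : Fin b → Fin d) (γ' : Fin m → Fin d) (i : Fin c.length),
      (Fin.append γ γ' ∘ (consPart b hb c).embedding i.succ : Fin (c.blocksFun i) → Fin d) =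
        γ' ∘ c.embedding i := by
    intro γ γ' i
    funext j
    have : (consPart b hb c).embedding i.succ j = Fin.natAdd b (c.embedding i j) := by
      refine Fin.ext ?_
      change (consPart b hb c).sizeUpTo ((i : ℕ) + 1) + (j : ℕ) = b + (c.sizeUpTo i + (j : ℕ))
      have : (consPart b hb c).sizeUpTo ((i : ℕ) + 1) = b + c.sizeUpTo i := by
        simp [Composition.sizeUpTo, consPart]
      omega
    exact (congrArg (Fin.append γ γ') this).trans (Fin.append_right γ γ' _)
  have h := Fin.prod_univ_succ (fun i : Fin (c.length + 1) =>
    X ((consPart b hb c).blocksFun i) (Fin.append α α' ∘ (consPart b hb c).embedding i)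
      (Fin.append β β' ∘ (consPart b hb c).embedding i))
  refine h.trans ?_
  refine congrArg₂ (· * ·) ?_ (Finset.prod_congr rfl fun i _ => ?_)
  · exact congrArg₂ (X b) (h0 α α') (h0 β β')
  · exact congrArg₂ (X (c.blocksFun i)) (hs α α' i) (hs β β' i)

/-- A composition of n + 1 is a first part j + 1 followed by a composition of n - j. Letting `F`
depend only on the list of blocks avoids transport along (j + 1) + (n - j) = n + 1. -/
theorem sum_composition_succ {M : Type*} [AddCommMonoid M] (F : List ℕ → M) (n : ℕ) :
    ∑ c : Composition (n + 1), F c.blocks =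
      ∑ j ∈ Finset.range (n + 1), ∑ c : Composition (n - j), F ((j + 1) :: c.blocks) := by
  rw [Finset.sum_sigma']
  symm
  refine Finset.sum_bij (fun (x : (Σ j : ℕ, Composition (n - j))) hx =>
    (⟨(x.1 + 1) :: x.2.blocks, ?_, ?_⟩ : Composition (n + 1))) ?_ ?_ ?_ ?_
  · intro i hi
    rcases List.mem_cons.1 hi with rfl | h
    · exact Nat.succ_pos _
    · exact x.2.blocks_pos h
  · have : x.1 < n + 1 := by simpa using hx
    rw [List.sum_cons, x.2.blocks_sum]
    omega
  · exact fun _ _ => Finset.mem_univ _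
  · rintro ⟨j, c⟩ _ ⟨j', c'⟩ _ h
    have h1 := congrArg Composition.blocks h
    simp only [List.cons.injEq, Nat.add_right_cancel_iff] at h1
    obtain ⟨rfl, h2⟩ := h1
    rw [Composition.ext h2]
  · intro c _
    have hsum := c.blocks_sum
    have hpos : ∀ i ∈ c.blocks, 0 < i := fun i hi => c.blocks_pos hi
    rcases hb : c.blocks with _ | ⟨b, l⟩
    · rw [hb] at hsum
      simp at hsum
    · rw [hb] at hsum hpos
      rw [List.sum_cons] at hsum
      have hb0 : 0 < b := hpos b (List.mem_cons_self)
      refine ⟨⟨b - 1, ⟨l, fun {i} hi => hpos i (List.mem_cons_of_mem _ hi), by omega⟩⟩, ?_, ?_⟩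
      · simp only [Finset.mem_sigma, Finset.mem_range, Finset.mem_univ, and_true]
        omega
      · refine Composition.ext ?_
        rw [hb]
        simp only [List.cons.injEq, and_true]
        omega
  · exact fun _ _ => rfl

end Compositions

/-! ### The renewal equation for the weights R_n². -/

section Renewal

theorem wordProd_append {H : Type*} [NormedAddCommGroup H] [InnerProductSpace ℂ H]
    {d : ℕ} (T : Fin d → H →L[ℂ] H) {m n : ℕ} (α : Fin m → Fin d) (β : Fin n → Fin d) :
    wordProd T (Fin.append α β) = wordProd T α ∘L wordProd T β := by
  have : (fun j => T (Fin.append α β j)) = Fin.append (fun j => T (α j)) (fun j => T (β j)) := by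
    funext j
    refine Fin.addCases (fun i => ?_) (fun i => ?_) j <;> simp
  rw [wordProd, this, List.ofFn_fin_append, List.prod_append]
  rfl

variable {H : Type*} [NormedAddCommGroup H] [InnerProductSpace ℂ H] [CompleteSpace H] {d : ℕ}

/-- Since T_{αα'} = T_α T_{α'}, tensoring coefficient matrices corresponds to composing the maps. -/
theorem sandwich_tensorBlocks_consPart (X : ∀ k : ℕ, WordMatrix d k) (T : Fin d → H →L[ℂ] H)
    (b : ℕ) (hb : 0 < b) {m : ℕ} (c : Composition m) (a : H →L[ℂ] H) :
    sandwich T (tensorBlocks X (consPart b hb c)) a =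
      phiTerm X T b (sandwich T (tensorBlocks X c) a) := by
  rw [sandwich, ← (Fin.appendEquiv b m).sum_comp, Fintype.sum_prod_type, phiTerm]
  refine Finset.sum_congr rfl fun α _ => ?_
  have h1 : ∀ β : Fin b → Fin d, X b α β • (wordProd T α ∘L sandwich T (tensorBlocks X c) a ∘L
      ContinuousLinearMap.adjoint (wordProd T β)) = ∑ α', ∑ β',
        (X b α β * tensorBlocks X c α' β') • ((wordProd T α ∘L wordProd T α') ∘L a ∘L
          ContinuousLinearMap.adjoint (wordProd T β ∘L wordProd T β')) := by
    intro β
    ext v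
    simp [sandwich, Finset.smul_sum, mul_smul]
  refine Eq.trans ?_ (Finset.sum_comm.trans (Finset.sum_congr rfl fun β _ => (h1 β).symm))
  refine Finset.sum_congr rfl fun α' _ => ?_
  rw [← (Fin.appendEquiv b m).sum_comp, Fintype.sum_prod_type]
  refine Finset.sum_congr rfl fun β _ => Finset.sum_congr rfl fun β' _ => ?_
  change tensorBlocks X (consPart b hb c) (Fin.append α α') (Fin.append β β') •
    (wordProd T (Fin.append α α') ∘L a ∘L
      ContinuousLinearMap.adjoint (wordProd T (Fin.append β β'))) = _
  rw [tensorBlocks_consPart, wordProd_append, wordProd_append]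

theorem sandwich_one_zero (T : Fin d → H →L[ℂ] H) (a : H →L[ℂ] H) {M : WordMatrix d 0}
    (hM : M default default = 1) : sandwich T M a = a := by
  have : ∀ α : Fin 0 → Fin d, wordProd T α = 1 := fun α => by simp [wordProd]
  rw [sandwich, Fintype.sum_unique, Fintype.sum_unique, this]
  refine (congrArg₂ (· • ·) hM rfl).trans ((one_smul ℂ _).trans ?_)
  ext v
  change a (star (1 : H →L[ℂ] H) v) = a v
  rw [star_one]
  rfl

theorem tensorBlocks_zero (X : ∀ k : ℕ, WordMatrix d k) (c : Composition 0)
    (α β : Fin 0 → Fin d) : tensorBlocks X c α β = 1 := by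
  have : IsEmpty (Fin c.length) := by
    rw [Composition.length, c.blocks_eq_nil.2 rfl]
    exact Fin.isEmpty
  rw [tensorBlocks, Matrix.of_apply, Fintype.prod_empty]

theorem sandwich_tensorBlocks (X : ∀ k : ℕ, WordMatrix d k) (T : Fin d → H →L[ℂ] H)
    (a : H →L[ℂ] H) (l : List ℕ) : ∀ (n : ℕ) (c : Composition n), c.blocks = l →
      sandwich T (tensorBlocks X c) a = l.foldr (phiTerm X T) a := by
  induction l with
  | nil =>
    intro n c hc
    obtain rfl : n = 0 := by rw [← c.blocks_sum, hc, List.sum_nil]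
    exact sandwich_one_zero T a (tensorBlocks_zero X c _ _)
  | cons b l ih =>
    intro n c hc
    have hpos : ∀ i ∈ b :: l, 0 < i := fun i hi => c.blocks_pos (hc ▸ hi)
    obtain rfl : n = b + l.sum := by rw [← c.blocks_sum, hc, List.sum_cons]
    have hb : 0 < b := hpos b List.mem_cons_self
    let c' : Composition l.sum := ⟨l, fun {i} hi => hpos i (List.mem_cons_of_mem _ hi), rfl⟩
    obtain rfl : c = consPart b hb c' := Composition.ext hc
    rw [sandwich_tensorBlocks_consPart, ih _ c' rfl, List.foldr_cons]

theorem sandwich_RSq (X : ∀ k : ℕ, WordMatrix d k) (T : Fin d → H →L[ℂ] H) (n : ℕ)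
    (a : H →L[ℂ] H) :
    sandwich T (RSq X n) a = ∑ c : Composition n, c.blocks.foldr (phiTerm X T) a := by
  rw [← Finset.sum_congr rfl fun c _ => sandwich_tensorBlocks X T a c.blocks n c rfl]
  simp only [sandwich, RSq, Matrix.sum_apply, Finset.sum_smul]
  rw [Finset.sum_comm]
  conv_rhs => rw [Finset.sum_comm]
  rw [Finset.sum_comm]
  refine Finset.sum_congr rfl fun α _ => ?_
  rw [Finset.sum_comm]

theorem sandwich_RSq_zero (X : ∀ k : ℕ, WordMatrix d k) (T : Fin d → H →L[ℂ] H)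
    (a : H →L[ℂ] H) : sandwich T (RSq X 0) a = a := by
  refine sandwich_one_zero T a ?_
  have : Subsingleton (Composition 0) :=
    ⟨fun a b => Composition.ext ((a.blocks_eq_nil.2 rfl).trans (b.blocks_eq_nil.2 rfl).symm)⟩
  rw [RSq, Matrix.sum_apply, Fintype.sum_subsingleton _ (⟨[], by simp, rfl⟩ : Composition 0),
    tensorBlocks_zero]

/-- The renewal equation for the operators `T^{(n)} (R_n² ⊗ a) T^{(n)*}`. -/
theorem sandwich_RSq_succ (X : ∀ k : ℕ, WordMatrix d k) (T : Fin d → H →L[ℂ] H) (n : ℕ)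
    (a : H →L[ℂ] H) :
    sandwich T (RSq X (n + 1)) a =
      ∑ j ∈ Finset.range (n + 1), phiTerm X T (j + 1) (sandwich T (RSq X (n - j)) a) := by
  rw [sandwich_RSq, sum_composition_succ]
  refine Finset.sum_congr rfl fun j _ => ?_
  rw [sandwich_RSq]
  exact (sandwich_sum T (X (j + 1)) _ _).symm

/-- A truncation of the resolvent identity Σ(a) = a + Φ(Σ(a)), with only finite sums. -/
theorem sum_sandwich_RSq_succ (X : ∀ k : ℕ, WordMatrix d k) (T : Fin d → H →L[ℂ] H) (N : ℕ)
    (a : H →L[ℂ] H) :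
    ∑ n ∈ Finset.range (N + 1), sandwich T (RSq X n) a =
      a + ∑ j ∈ Finset.range N,
        phiTerm X T (j + 1) (∑ n ∈ Finset.range (N - j), sandwich T (RSq X n) a) := by
  rw [Finset.sum_range_succ', sandwich_RSq_zero, add_comm]
  congr 1
  simp only [sandwich_RSq_succ]
  rw [Finset.sum_range_diag_flip N
    (fun j n => phiTerm X T (j + 1) (sandwich T (RSq X n) a))]
  exact Finset.sum_congr rfl fun j _ => (sandwich_sum T (X (j + 1)) _ _).symm

end Renewal

/-! ### Inverting I - Φ_T by positivity and purity. -/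

section Resolvent

variable {H : Type*} [NormedAddCommGroup H] [InnerProductSpace ℂ H] [CompleteSpace H]
  {d : ℕ} {X : ∀ k : ℕ, WordMatrix d k} {T : Fin d → H →L[ℂ] H}

/-- If the shorter partial sums are at most Q, the truncated identity bounds the next one by (Q -
Φ(Q)) + Φ(Q) = Q. -/
theorem sum_sandwich_RSq_le (hX : IsAdmissible X) (hT : PhiConverges X T) {Q : H →L[ℂ] H}
    (hQ : 0 ≤ Q) (N : ℕ) :
    ∑ n ∈ Finset.range N, sandwich T (RSq X n) (Q - Phi X T Q) ≤ Q := by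
  induction N using Nat.strong_induction_on with
  | _ N ih =>
    cases N with
    | zero => simpa using hQ
    | succ N =>
      rw [sum_sandwich_RSq_succ]
      calc _ ≤ Q - Phi X T Q + ∑ j ∈ Finset.range N, phiTerm X T (j + 1) Q :=
            add_le_add_right (Finset.sum_le_sum fun j _ =>
              sandwich_mono T (hX.posSemidef _ (Nat.le_add_left 1 j))
                (ih _ (Nat.lt_succ_of_le (Nat.sub_le N j)))) _
        _ ≤ Q - Phi X T Q + Phi X T Q :=
            add_le_add_right (sum_phiTerm_le_Phi hX hT hQ N) _
        _ = Q := sub_add_cancel _ _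

theorem Phi_iterate_mono (hX : IsAdmissible X) (hT : PhiConverges X T) (m : ℕ) {a b : H →L[ℂ] H}
    (hab : a ≤ b) : (Phi X T)^[m] a ≤ (Phi X T)^[m] b :=
  Monotone.iterate (fun _ _ h => Phi_mono hX hT h) m hab

/-- If `Φ_T^m(I) → 0`, then a positive contraction `E` with `E ≤ Φ_T(E)` vanishes. -/
theorem eq_zero_of_le_Phi (hX : IsAdmissible X) (hT : IsPureContractive X T) {E : H →L[ℂ] H}
    (hE0 : 0 ≤ E) (hE1 : E ≤ 1) (hE : E ≤ Phi X T E) : E = 0 := by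
  refine le_antisymm ?_ hE0
  have hm : ∀ m, E ≤ (Phi X T)^[m] 1 := by
    intro m
    refine le_trans ?_ (Phi_iterate_mono hX hT.converges m hE1)
    induction m with
    | zero => exact le_rfl
    | succ m ih =>
      rw [Function.iterate_succ_apply']
      exact hE.trans (Phi_mono hX hT.converges ih)
  rw [clm_le_iff_inner_le]
  intro x
  have hlim : Tendsto (fun m => ⟪x, (Phi X T)^[m] 1 x⟫_ℂ) atTop (𝓝 ⟪x, (0 : H →L[ℂ] H) x⟫_ℂ) :=
    tendsto_const_nhds.inner (hT.pure.2 x)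
  exact ge_of_tendsto hlim (Eventually.of_forall fun m => (clm_le_iff_inner_le _ _).1 (hm m) x)

/-- The weak limit of `∑_n T^{(n)} (R_n² ⊗ (Q - Φ_T(Q))) T^{(n)*}` is `Q`. -/
theorem eq_of_tendsto_sum_sandwich_RSq (hX : IsAdmissible X) (hT : IsPureContractive X T)
    {Q S : H →L[ℂ] H} (hQ : 0 ≤ Q) (hQ1 : Q ≤ 1) (hPhi : Phi X T Q ≤ Q)
    (hS : ∀ u v, Tendsto (fun N => ⟪u, (∑ n ∈ Finset.range N,
      sandwich T (RSq X n) (Q - Phi X T Q)) v⟫_ℂ) atTop (𝓝 ⟪u, S v⟫_ℂ)) : S = Q := by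
  have ha : 0 ≤ Q - Phi X T Q := sub_nonneg.2 hPhi
  have hSQ : S ≤ Q := by
    rw [clm_le_iff_inner_le]
    exact fun x => le_of_tendsto (hS x x) (Eventually.of_forall fun N =>
      (clm_le_iff_inner_le _ _).1 (sum_sandwich_RSq_le hX hT.converges hQ N) x)
  have hS0 : 0 ≤ S := by
    rw [clm_le_iff_inner_le]
    exact fun x => ge_of_tendsto (hS x x) (Eventually.of_forall fun N =>
      (clm_le_iff_inner_le _ _).1 (Finset.sum_nonneg fun n _ =>
        sandwich_nonneg T (RSq_posDef hX n).posSemidef ha) x)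
  -- Keep only the terms j < M of the truncated identity, the others being positive. Let N tend to
  -- infinity with M fixed, and only then let M grow.
  have hPS : Phi X T S ≤ S - (Q - Phi X T Q) := by
    refine Phi_le_of_sum_phiTerm_le hX hT.converges fun M => ?_
    rw [le_sub_iff_add_le', clm_le_iff_inner_le]
    intro x
    have hr : Tendsto (fun N => ⟪x, (∑ n ∈ Finset.range (N + 1),
        sandwich T (RSq X n) (Q - Phi X T Q)) x⟫_ℂ) atTop (𝓝 ⟪x, S x⟫_ℂ) :=
      (hS x x).comp (tendsto_add_atTop_nat 1)
    have hl : Tendsto (fun N => ⟪x, (Q - Phi X T Q + ∑ j ∈ Finset.range M, phiTerm X T (j + 1)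
        (∑ n ∈ Finset.range (N - j), sandwich T (RSq X n) (Q - Phi X T Q))) x⟫_ℂ) atTop
        (𝓝 ⟪x, (Q - Phi X T Q + ∑ j ∈ Finset.range M, phiTerm X T (j + 1) S) x⟫_ℂ) := by
      simp only [add_apply, sum_apply, inner_add_right, inner_sum]
      refine tendsto_const_nhds.add (tendsto_finsetSum _ fun j _ => ?_)
      exact sandwich_tendsto_inner T (X (j + 1))
        (fun u v => (hS u v).comp (tendsto_sub_atTop_nat j)) x x
    refine le_of_tendsto_of_tendsto hl hr ((eventually_ge_atTop M).mono fun N hN => ?_)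
    refine (clm_le_iff_inner_le _ _).1 ?_ x
    rw [sum_sandwich_RSq_succ]
    refine add_le_add_right (Finset.sum_le_sum_of_subset_of_nonneg (Finset.range_mono hN)
      fun j _ _ => phiTerm_nonneg hX j ?_) _
    exact Finset.sum_nonneg fun n _ => sandwich_nonneg T (RSq_posDef hX n).posSemidef ha
  -- The defect E = Q - S satisfies E ≤ Φ(E), so purity gives E = 0.
  have hE : Q - S = 0 := by
    refine eq_zero_of_le_Phi hX hT (sub_nonneg.2 hSQ) ((sub_le_self Q hS0).trans hQ1) ?_
    calc Q - S = Phi X T Q - (S - (Q - Phi X T Q)) := by abel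
      _ ≤ Phi X T Q - Phi X T S := sub_le_sub_left hPS _
      _ = Phi X T (Q - S) := (Phi_sub hX hT.converges Q S).symm
  exact (sub_eq_zero.1 hE).symm

end Resolvent

/-! ### Hilbert tensor products realised as columns. -/

section TensorColumn

variable {d : ℕ} (D : Type*) [NormedAddCommGroup D] [InnerProductSpace ℂ D]

theorem norm_toLp_smul {ι : Type*} [Fintype ι] (ξ : EuclideanSpace ℂ ι) (y : D) :
    ‖(WithLp.toLp 2 fun α => ξ α • y : PiLp 2 (fun _ : ι => D))‖ = ‖ξ‖ * ‖y‖ := by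
  rw [PiLp.norm_eq_of_L2, EuclideanSpace.norm_eq, ← Real.sqrt_sq (norm_nonneg y),
    ← Real.sqrt_mul (Finset.sum_nonneg fun _ _ => sq_nonneg _), Finset.sum_mul]
  simp only [norm_smul, mul_pow]

/-- The bilinear map `(f, y) ↦ (f_α y)_α`. -/
noncomputable def fockSMul : Fock d →ₗ[ℂ] D →ₗ[ℂ] ColumnSpace (fun k => Fin k → Fin d) D :=
  LinearMap.mk₂ ℂ
    (fun f y => ⟨fun k => WithLp.toLp 2 fun α => f k α • y, by
      refine memℓp_gen ?_
      simp only [norm_toLp_smul, ENNReal.toReal_ofNat, Real.rpow_ofNat, mul_pow]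
      have := (lp.memℓp f).summable (by norm_num)
      simp only [ENNReal.toReal_ofNat, Real.rpow_ofNat] at this
      exact this.mul_right _⟩)
    (fun f g y => by ext1; funext k; ext α; exact add_smul (f k α) (g k α) y)
    (fun c f y => by ext1; funext k; ext α; exact mul_smul c (f k α) y)
    (fun f y z => by ext1; funext k; ext α; exact smul_add (f k α) y z)
    (fun c f y => by ext1; funext k; ext α; exact smul_comm (f k α) c y)

theorem fockSMul_apply (f : Fock d) (y : D) (k : ℕ) (α : Fin k → Fin d) :
    fockSMul D f y k α = f k α • y := rfl

theorem inner_fockSMul (f g : Fock d) (y z : D) :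
    ⟪fockSMul D f y, fockSMul D g z⟫_ℂ = ⟪f, g⟫_ℂ * ⟪y, z⟫_ℂ := by
  refine (column_hasSum_inner (fockSMul D f y) (fockSMul D g z)).unique ?_
  have h : (fun k => ∑ γ, ⟪fockSMul D f y k γ, fockSMul D g z k γ⟫_ℂ) =
      fun k => ⟪f k, g k⟫_ℂ * ⟪y, z⟫_ℂ := funext fun k => ?_
  · rw [h]
    exact (lp.hasSum_inner (𝕜 := ℂ) f g).mul_right _
  rw [PiLp.inner_apply, Finset.sum_mul]
  refine Finset.sum_congr rfl fun α _ => ?_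
  rw [fockSMul_apply, fockSMul_apply, inner_smul_left, inner_smul_right, RCLike.inner_apply']
  ring

/-- The isometry `f ⊗ y ↦ (f_α y)_α` on the algebraic tensor product. -/
noncomputable def fockTensorIsometry :
    Fock d ⊗[ℂ] D →ₗᵢ[ℂ] ColumnSpace (fun k => Fin k → Fin d) D :=
  (TensorProduct.lift (fockSMul D)).isometryOfInner fun s t => by
    induction s with
    | zero => simp
    | add s s' hs hs' => rw [map_add, inner_add_left, inner_add_left, hs, hs']
    | tmul f y =>
      induction t with
      | zero => simp
      | add t t' ht ht' => rw [map_add, inner_add_right, inner_add_right, ht, ht']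
      | tmul g z =>
        rw [TensorProduct.lift.tmul, TensorProduct.lift.tmul, inner_fockSMul,
          TensorProduct.inner_tmul]

variable [CompleteSpace D]

variable {F : Type*} [NormedAddCommGroup F] [InnerProductSpace ℂ F]

/-- The isometry `f ⊗ y ↦ ((ι f)_α y)_α` on a Hilbert space tensor product, for an isometry `ι` into
the Fock space. -/
noncomputable def tensorColumn (ι : F →ₗᵢ[ℂ] Fock d) :
    HilbertTensor F D →L[ℂ] ColumnSpace (fun k => Fin k → Fin d) D :=
  ((fockTensorIsometry D).comp
    (TensorProduct.mapIsometry ι LinearIsometry.id)).toContinuousLinearMap.fromCompletion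

theorem tensorColumn_coe (ι : F →ₗᵢ[ℂ] Fock d) (f : F) (y : D) :
    tensorColumn D ι ((f ⊗ₜ[ℂ] y : F ⊗[ℂ] D) : HilbertTensor F D) = fockSMul D (ι f) y := by
  rw [tensorColumn, ContinuousLinearMap.fromCompletion_apply_coe]
  rfl

theorem norm_tensorColumn (ι : F →ₗᵢ[ℂ] Fock d) (t : HilbertTensor F D) :
    ‖tensorColumn D ι t‖ = ‖t‖ := by
  induction t using UniformSpace.Completion.induction_on with
  | hp => exact isClosed_eq (tensorColumn D ι).continuous.norm continuous_norm
  | ih t =>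
    rw [tensorColumn, ContinuousLinearMap.fromCompletion_apply_coe,
      UniformSpace.Completion.norm_coe]
    exact LinearIsometry.norm_map _ _

theorem isClosed_range_tensorColumn (ι : F →ₗᵢ[ℂ] Fock d) :
    IsClosed (Set.range (tensorColumn D ι)) :=
  (AddMonoidHomClass.isometry_of_norm _ (norm_tensorColumn D ι)).isClosedEmbedding.isClosed_range

theorem adjoint_tensorColumn_apply (ι : F →ₗᵢ[ℂ] Fock d) (t : HilbertTensor F D) :
    ContinuousLinearMap.adjoint (tensorColumn D ι) (tensorColumn D ι t) = t := by
  have := (ContinuousLinearMap.norm_map_iff_adjoint_comp_self (tensorColumn D ι)).1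
    (norm_tensorColumn D ι)
  exact congrArg (fun A => A t) this

end TensorColumn

/-! ### Symmetric tensors with vector coefficients. -/

section Symmetric

variable {d : ℕ}

/-- The symmetrization of the basis vector `e_β`. -/
noncomputable def symBasis {k : ℕ} (β : Fin k → Fin d) : TensorPow d k :=
  WithLp.toLp 2 fun γ => ((k.factorial : ℂ))⁻¹ *
    ∑ σ : Equiv.Perm (Fin k), if γ ∘ σ = β then 1 else 0

theorem symBasis_mem {k : ℕ} (β : Fin k → Fin d) : symBasis β ∈ symTensors d k := by
  intro τ γ
  change (_ : ℂ)⁻¹ * _ = (_ : ℂ)⁻¹ * _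
  rw [← Equiv.sum_comp (Equiv.mulLeft τ)
    (fun σ : Equiv.Perm (Fin k) => if γ ∘ σ = β then (1 : ℂ) else 0)]
  rfl

/-- Averaging over permutations fixes a symmetric family, so ∑_β e_β ⊗ w_β is unchanged when each
e_β is replaced by its symmetrization. -/
theorem sum_symBasis_smul {D : Type*} [AddCommGroup D] [Module ℂ D] {k : ℕ}
    (w : (Fin k → Fin d) → D) (hw : ∀ (σ : Equiv.Perm (Fin k)) α, w (α ∘ σ) = w α)
    (γ : Fin k → Fin d) : ∑ β, symBasis β γ • w β = w γ := by
  have : ∀ β, symBasis β γ • w β = ((k.factorial : ℂ))⁻¹ •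
      ∑ σ : Equiv.Perm (Fin k), if γ ∘ σ = β then w β else 0 := by
    intro β
    change ((_ : ℂ)⁻¹ * _) • _ = _
    rw [mul_smul, Finset.sum_smul]
    simp only [ite_smul, one_smul, zero_smul]
  simp only [this]
  rw [← Finset.smul_sum, Finset.sum_comm]
  simp only [Finset.sum_ite_eq, Finset.mem_univ, if_true, hw]
  rw [Finset.sum_const, Finset.card_univ, Fintype.card_perm, Fintype.card_fin,
    ← Nat.cast_smul_eq_nsmul ℂ, smul_smul, inv_mul_cancel₀ (by exact_mod_cast k.factorial_ne_zero),
    one_smul]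

theorem single_mem_weightedDA (X : ∀ k : ℕ, WordMatrix d k) (k : ℕ) {ξ : TensorPow d k}
    (hξ : ξ ∈ RSym X k) : (lp.single 2 k ξ : Fock d) ∈ weightedDA X := by
  intro j
  by_cases h : j = k
  · subst h
    rwa [lp.single_apply_self]
  · rw [lp.single_apply_ne _ _ _ h]
    exact zero_mem _

/-- The column `∑_β r_{γ,β} w_β`, with `w` symmetric, lies in `𝓕(𝓡) ⊗ D`. -/
theorem mem_range_tensorColumn {D : Type*} [NormedAddCommGroup D] [InnerProductSpace ℂ D]
    [CompleteSpace D] (X : ∀ k : ℕ, WordMatrix d k)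
    (F : ColumnSpace (fun k => Fin k → Fin d) D) (w : ∀ k, (Fin k → Fin d) → D)
    (hw : ∀ k (σ : Equiv.Perm (Fin k)) α, w k (α ∘ σ) = w k α)
    (hF : ∀ k γ, F k γ = ∑ β, R X k γ β • w k β) :
    F ∈ Set.range (tensorColumn D (weightedDA X).subtypeₗᵢ) := by
  -- The range is closed and `F` is the sum of its homogeneous components, so one degree at a time
  -- suffices. In degree k the preimage is ∑_β R_k(sym e_β) ⊗ w_β.
  refine (isClosed_range_tensorColumn D (weightedDA X).subtypeₗᵢ).mem_of_tendsto
    (lp.hasSum_single (by norm_num) F) (Eventually.of_forall fun s => ?_)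
  change _ ∈ LinearMap.range
    (tensorColumn D (weightedDA X).subtypeₗᵢ : HilbertTensor (weightedDA X) D →ₗ[ℂ]
      ColumnSpace (fun k => Fin k → Fin d) D)
  refine Submodule.sum_mem _ fun k _ => ?_
  have hmem : ∀ β : Fin k → Fin d, Matrix.toEuclideanCLM (𝕜 := ℂ) (R X k) (symBasis β) ∈
      RSym X k := fun β => ⟨symBasis β, symBasis_mem β, rfl⟩
  refine ⟨∑ β, (((⟨lp.single 2 k (Matrix.toEuclideanCLM (𝕜 := ℂ) (R X k) (symBasis β)),
    single_mem_weightedDA X k (hmem β)⟩ : weightedDA X) ⊗ₜ[ℂ] w k β :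
      weightedDA X ⊗[ℂ] D) : HilbertTensor (weightedDA X) D), ?_⟩
  refine (map_sum (tensorColumn D (weightedDA X).subtypeₗᵢ) _ _).trans ?_
  simp only [tensorColumn_coe]
  ext j γ
  rw [lp.coeFn_sum, Finset.sum_apply, WithLp.ofLp_sum, Finset.sum_apply]
  by_cases h : j = k
  · subst h
    have hβ : ∀ β, (lp.single 2 j (Matrix.toEuclideanCLM (𝕜 := ℂ) (R X j) (symBasis β)) : Fock d)
        j γ • w j β = ∑ δ, R X j γ δ • symBasis β δ • w j β := by
      intro β
      rw [lp.single_apply_self]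
      simp only [smul_smul, ← Finset.sum_smul]
      rfl
    refine (Finset.sum_congr rfl fun β _ => hβ β).trans ?_
    rw [Finset.sum_comm, lp.single_apply_self, hF]
    simp only [← Finset.smul_sum, sum_symBasis_smul (w j) (hw j)]
  · have hβ : ∀ β, (lp.single 2 k (Matrix.toEuclideanCLM (𝕜 := ℂ) (R X k) (symBasis β)) : Fock d)
        j γ • w k β = 0 := by
      intro β
      rw [lp.single_apply_ne _ _ _ h, PiLp.zero_apply, zero_smul]
    refine (Finset.sum_congr rfl fun β _ => hβ β).trans ?_
    rw [lp.single_apply_ne _ _ _ h, Finset.sum_const_zero, PiLp.zero_apply]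

end Symmetric

/-! ### Evaluating tensors at a commuting tuple. -/

section WordEvaluation

variable {H : Type*} [NormedAddCommGroup H] [InnerProductSpace ℂ H] {d : ℕ}

/-- `∑_β ξ_β T_β`. -/
noncomputable def evalWord {k : ℕ} (T : Fin d → H →L[ℂ] H) (ξ : TensorPow d k) : H →L[ℂ] H :=
  ∑ β, ξ β • wordProd T β

theorem evalWord_creation (T : Fin d → H →L[ℂ] H) (i : Fin d) {k : ℕ} (ξ : TensorPow d k) :
    evalWord T (creation i k ξ) = T i ∘L evalWord T ξ := by
  rw [evalWord, ← (Fin.consEquiv (fun _ : Fin (k + 1) => Fin d)).sum_comp,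
    Fintype.sum_prod_type, Fintype.sum_eq_single i]
  · ext v
    simp [creation, evalWord, Fin.consEquiv, wordProd, List.ofFn_succ]
  · intro j hj
    simp [creation, Fin.consEquiv, hj]

theorem wordProd_comp_perm {T : Fin d → H →L[ℂ] H} (hT : ∀ i j, T i ∘L T j = T j ∘L T i) {k : ℕ}
    (σ : Equiv.Perm (Fin k)) (α : Fin k → Fin d) : wordProd T (α ∘ σ) = wordProd T α := by
  refine (Equiv.Perm.ofFn_comp_perm σ fun j => T (α j)).prod_eq' ?_
  refine List.pairwise_of_forall_mem_list fun a ha b hb => ?_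
  obtain ⟨i, rfl⟩ := List.mem_ofFn.1 ha
  obtain ⟨j, rfl⟩ := List.mem_ofFn.1 hb
  exact hT _ _

/-- Symmetric evaluation annihilates the orthogonal complement of the symmetric tensors. -/
theorem evalWord_eq_of_forall_inner {T : Fin d → H →L[ℂ] H}
    (hT : ∀ i j, T i ∘L T j = T j ∘L T i) {k : ℕ} {ξ ζ : TensorPow d k}
    (h : ∀ η ∈ symTensors d k, ⟪η, ξ⟫_ℂ = ⟪η, ζ⟫_ℂ) : evalWord T ξ = evalWord T ζ := by
  ext v
  refine ext_inner_left ℂ fun u => ?_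
  -- The functional is represented by the tensor with entries ⟨T_β v, u⟩, which is symmetric because
  -- the T_i commute.
  have key : ∀ θ : TensorPow d k, ⟪u, evalWord T θ v⟫_ℂ =
      ⟪(WithLp.toLp 2 fun β => ⟪wordProd T β v, u⟫_ℂ : TensorPow d k), θ⟫_ℂ := by
    intro θ
    rw [evalWord, sum_apply, inner_sum, PiLp.inner_apply]
    refine Finset.sum_congr rfl fun β _ => ?_
    rw [smul_apply, inner_smul_right, RCLike.inner_apply', inner_conj_symm, mul_comm]
  rw [key, key]
  refine h _ fun σ α => ?_
  change ⟪wordProd T (α ∘ σ) v, u⟫_ℂ = ⟪wordProd T α v, u⟫_ℂ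
  rw [wordProd_comp_perm hT]

end WordEvaluation

/-! ### The weighted shift under evaluation. -/

section WeightedShift

open scoped MatrixOrder

variable {H : Type*} [NormedAddCommGroup H] [InnerProductSpace ℂ H] {d : ℕ}
  {X : ∀ k : ℕ, WordMatrix d k}

theorem R_isHermitian (X : ∀ k : ℕ, WordMatrix d k) (k : ℕ) : (R X k)ᴴ = R X k :=
  (Matrix.nonneg_iff_posSemidef.1 (CFC.sqrt_nonneg (RSq X k))).isHermitian

theorem R_mul_R (hX : IsAdmissible X) (k : ℕ) : R X k * R X k = RSq X k :=
  CFC.sqrt_mul_sqrt_self _ (RSq_posDef hX k).posSemidef.nonneg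

theorem isUnit_det_R (hX : IsAdmissible X) (k : ℕ) : IsUnit (R X k).det := by
  have h := (Matrix.isUnit_iff_isUnit_det _).1 (RSq_posDef hX k).isUnit
  rw [← R_mul_R hX, Matrix.det_mul] at h
  exact isUnit_of_mul_isUnit_left h

/-- `R_k` as an operator. -/
noncomputable abbrev ROp (X : ∀ k : ℕ, WordMatrix d k) (k : ℕ) : TensorPow d k →L[ℂ] TensorPow d k :=
  Matrix.toEuclideanCLM (𝕜 := ℂ) (R X k)

theorem ROp_apply (X : ∀ k : ℕ, WordMatrix d k) (k : ℕ) (ξ : TensorPow d k) (γ : Fin k → Fin d) :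
    ROp X k ξ γ = ∑ β, R X k γ β * ξ β := rfl

theorem inner_ROp (X : ∀ k : ℕ, WordMatrix d k) (k : ℕ) (ξ ζ : TensorPow d k) :
    ⟪ROp X k ξ, ζ⟫_ℂ = ⟪ξ, ROp X k ζ⟫_ℂ := by
  rw [← ContinuousLinearMap.adjoint_inner_right, ← ContinuousLinearMap.star_eq_adjoint, ROp,
    ← map_star, Matrix.star_eq_conjTranspose, R_isHermitian]

theorem idTensor_creation {k : ℕ} (A : WordMatrix d k) (i : Fin d) (ξ : TensorPow d k) :
    Matrix.toEuclideanCLM (𝕜 := ℂ) (idTensor A) (creation i k ξ) =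
      creation i k (Matrix.toEuclideanCLM (𝕜 := ℂ) A ξ) := by
  ext γ
  change ∑ β, idTensor A γ β * creation i k ξ β =
    if γ 0 = i then ∑ β, A (Fin.tail γ) β * ξ β else 0
  rw [← (Fin.consEquiv (fun _ : Fin (k + 1) => Fin d)).sum_comp,
    Fintype.sum_prod_type, Fintype.sum_eq_single i]
  · by_cases h : γ 0 = i
    · simp [creation, Fin.consEquiv, idTensor, h]
    · simp [creation, Fin.consEquiv, idTensor, h]
  · intro j hj
    simp [creation, Fin.consEquiv, hj]

/-- The factor R_{k+1} cancels the inverse in Z_{k+1}, leaving I ⊗ R_k: after applying R, the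
weighted shift becomes the plain creation operator. -/
theorem ROp_fockShift (hX : IsAdmissible X) (i : Fin d) (f : Fock d) (k : ℕ) :
    ROp X (k + 1) (fockShift hX i f (k + 1)) = creation i k (ROp X k (f k)) := by
  rw [← idTensor_creation]
  change Matrix.toEuclideanCLM (𝕜 := ℂ) (R X (k + 1))
    (Matrix.toEuclideanCLM (𝕜 := ℂ) (Z X (k + 1)) (creation i k (f k))) = _
  rw [← mul_apply_eq_comp, ← map_mul, Z, ← Matrix.mul_assoc,
    Matrix.mul_nonsing_inv _ (isUnit_det_R hX (k + 1)), Matrix.one_mul]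

/-- Evaluation sees R_k g_k only through pairings with symmetric η, and ⟨η, R_k g_k⟩ = ⟨R_k η, g_k⟩
with R_k η in 𝓕(𝓡). So the compression does not change the value. -/
theorem evalWord_ROp_projection {T : Fin d → H →L[ℂ] H} (hT : ∀ i j, T i ∘L T j = T j ∘L T i)
    (g : Fock d) (k : ℕ) :
    evalWord T (ROp X k (((weightedDA X).orthogonalProjectionOnto g : Fock d) k)) =
      evalWord T (ROp X k (g k)) := by
  refine evalWord_eq_of_forall_inner hT fun η hη => ?_
  rw [← inner_ROp, ← inner_ROp]
  have hmem := single_mem_weightedDA X k (ξ := ROp X k η) ⟨η, hη, rfl⟩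
  have := (weightedDA X).inner_orthogonalProjectionOnto_eq_of_mem_left ⟨_, hmem⟩ g
  rw [Submodule.coe_inner] at this
  simpa [lp.inner_single_left] using this

theorem evalWord_weightedShift_succ (hX : IsAdmissible X) {T : Fin d → H →L[ℂ] H}
    (hT : ∀ i j, T i ∘L T j = T j ∘L T i) (i : Fin d) (f : weightedDA X) (k : ℕ) :
    evalWord T (ROp X (k + 1) ((weightedShift hX i f : Fock d) (k + 1))) =
      T i ∘L evalWord T (ROp X k ((f : Fock d) k)) := by
  rw [← evalWord_creation, ← ROp_fockShift hX]
  exact evalWord_ROp_projection hT _ _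

theorem evalWord_weightedShift_zero (hX : IsAdmissible X) {T : Fin d → H →L[ℂ] H}
    (hT : ∀ i j, T i ∘L T j = T j ∘L T i) (i : Fin d) (f : weightedDA X) :
    evalWord T (ROp X 0 ((weightedShift hX i f : Fock d) 0)) = 0 := by
  refine (evalWord_ROp_projection hT (fockShift hX i f) 0).trans ?_
  have : fockShift hX i f 0 = 0 := rfl
  rw [this, map_zero]
  simp [evalWord]

end WeightedShift

/-! ### The Poisson kernel. -/

section PoissonKernel

variable {H : Type*} [NormedAddCommGroup H] [InnerProductSpace ℂ H] [CompleteSpace H]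
  {d : ℕ} {X : ∀ k : ℕ, WordMatrix d k} {T : Fin d → H →L[ℂ] H}

theorem inner_sandwich_RSq (hX : IsAdmissible X) (k : ℕ) (b : H →L[ℂ] H) (u v : H) :
    ⟪u, sandwich T (RSq X k) (star b * b) v⟫_ℂ =
      ∑ γ, ⟪b (krausOp T (R X k) γ u), b (krausOp T (R X k) γ v)⟫_ℂ := by
  rw [← R_mul_R hX]
  nth_rw 1 [← R_isHermitian X k]
  rw [inner_sandwich]
  refine Finset.sum_congr rfl fun γ _ => ?_
  rw [mul_apply_eq_comp, ContinuousLinearMap.star_eq_adjoint,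
    ContinuousLinearMap.adjoint_inner_right]

/-- The Poisson kernel of a positive contraction `Q` with `Φ_T(Q) ≤ Q`. -/
theorem exists_poissonKernel (hX : IsAdmissible X) (hT : IsPureContractive X T)
    {Q : H →L[ℂ] H} (hQ : 0 ≤ Q) (hQ1 : Q ≤ 1) (hPhi : Phi X T Q ≤ Q) :
    ∃ (b : H →L[ℂ] H) (G : H →L[ℂ] ColumnSpace (fun k => Fin k → Fin d) H),
      (∀ v k γ, G v k γ = b (krausOp T (R X k) γ v)) ∧ ContinuousLinearMap.adjoint G ∘L G = Q := by
  obtain ⟨b, hb⟩ := CStarAlgebra.nonneg_iff_eq_star_mul_self.1 (sub_nonneg.2 hPhi)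
  -- The bound 1 comes from the partial sums being at most Q ≤ I.
  obtain ⟨G, hG⟩ := exists_column (ι := fun k => Fin k → Fin d)
    (fun k γ => b ∘L krausOp T (R X k) γ) 1 (by
      intro v s
      have h1 : ∀ k, ⟪v, sandwich T (RSq X k) (star b * b) v⟫_ℂ =
          ((∑ γ, ‖(b ∘L krausOp T (R X k) γ) v‖ ^ 2 : ℝ) : ℂ) := by
        intro k
        rw [inner_sandwich_RSq hX]
        push_cast
        exact Finset.sum_congr rfl fun γ _ => inner_self_eq_norm_sq_to_K (𝕜 := ℂ) _
      obtain ⟨N, hN⟩ := s.exists_nat_subset_range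
      refine (Finset.sum_le_sum_of_subset_of_nonneg hN fun _ _ _ =>
        Finset.sum_nonneg fun _ _ => sq_nonneg _).trans ?_
      have h2 := (clm_le_iff_inner_le _ _).1
        ((sum_sandwich_RSq_le hX hT.converges hQ N).trans hQ1) v
      change _ ≤ ⟪v, v⟫_ℂ at h2
      rw [hb, sum_apply, inner_sum, Finset.sum_congr rfl fun k _ => h1 k, ← Complex.ofReal_sum,
        inner_self_eq_norm_sq_to_K] at h2
      rw [one_mul]
      exact Complex.real_le_real.1 (h2.trans_eq (by push_cast; rfl)))
  refine ⟨b, G, hG, eq_of_tendsto_sum_sandwich_RSq hX hT hQ hQ1 hPhi fun u v => ?_⟩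
  rw [ContinuousLinearMap.comp_apply, ContinuousLinearMap.adjoint_inner_right]
  refine (column_hasSum_inner (G u) (G v)).tendsto_sum_nat.congr fun N => ?_
  rw [hb, sum_apply, inner_sum]
  refine Finset.sum_congr rfl fun k _ => ?_
  rw [inner_sandwich_RSq hX]
  simp only [hG, ContinuousLinearMap.comp_apply]

/-- This computes G^*(f ⊗ y) weakly, as ∑_k (R_k f_k)(T) b^*y. -/
theorem krausOp_hasSum_inner {b : H →L[ℂ] H}
    {G : H →L[ℂ] ColumnSpace (fun k => Fin k → Fin d) H}
    (hG : ∀ v k γ, G v k γ = b (krausOp T (R X k) γ v)) (f : Fock d) (u y : H) :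
    HasSum (fun k => ⟪u, evalWord T (ROp X k (f k)) (ContinuousLinearMap.adjoint b y)⟫_ℂ)
      ⟪G u, fockSMul H f y⟫_ℂ := by
  have h : (fun k => ⟪u, evalWord T (ROp X k (f k)) (ContinuousLinearMap.adjoint b y)⟫_ℂ) =
      fun k => ∑ γ, ⟪G u k γ, fockSMul H f y k γ⟫_ℂ := funext fun k => ?_
  · rw [h]
    exact column_hasSum_inner (G u) (fockSMul H f y)
  have h1 : evalWord T (ROp X k (f k)) =
      ∑ γ, f k γ • ContinuousLinearMap.adjoint (krausOp T (R X k) γ) := by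
    simp only [evalWord, ROp_apply, adjoint_krausOp, Finset.smul_sum, Finset.sum_smul]
    rw [Finset.sum_comm]
    refine Finset.sum_congr rfl fun γ _ => Finset.sum_congr rfl fun β _ => ?_
    rw [smul_smul, ← Matrix.conjTranspose_apply, R_isHermitian, mul_comm]
  rw [h1, sum_apply, inner_sum]
  refine Finset.sum_congr rfl fun γ _ => ?_
  rw [smul_apply, inner_smul_right, ContinuousLinearMap.adjoint_inner_right,
    ContinuousLinearMap.adjoint_inner_right, hG, fockSMul_apply, inner_smul_right]

/-- The adjoint of the Poisson kernel intertwines `W_i ⊗ I` and `T_i`. -/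
theorem poissonKernel_intertwines {F : Type*} [NormedAddCommGroup F] [InnerProductSpace ℂ F]
    (ι : F →ₗᵢ[ℂ] Fock d) {A : F →L[ℂ] F} {i : Fin d}
    (hzero : ∀ f, evalWord T (ROp X 0 (ι (A f) 0)) = 0)
    (hsucc : ∀ f k, evalWord T (ROp X (k + 1) (ι (A f) (k + 1))) =
      T i ∘L evalWord T (ROp X k (ι f k))) {b : H →L[ℂ] H}
    {G : H →L[ℂ] ColumnSpace (fun k => Fin k → Fin d) H}
    (hG : ∀ v k γ, G v k γ = b (krausOp T (R X k) γ v)) :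
    T i ∘L (ContinuousLinearMap.adjoint G ∘L tensorColumn H ι) =
      (ContinuousLinearMap.adjoint G ∘L tensorColumn H ι) ∘L tensorId H A := by
  ext t
  induction t using UniformSpace.Completion.induction_on with
  | hp => exact isClosed_eq (ContinuousLinearMap.continuous _) (ContinuousLinearMap.continuous _)
  | ih t =>
    induction t with
    | zero => rw [UniformSpace.Completion.coe_zero, map_zero, map_zero]
    | add s t hs ht => rw [UniformSpace.Completion.coe_add, map_add, map_add, hs, ht]
    | tmul f y =>
      have hA : tensorId H A ((f ⊗ₜ[ℂ] y : F ⊗[ℂ] H) : HilbertTensor F H) =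
          ((A f ⊗ₜ[ℂ] y : F ⊗[ℂ] H) : HilbertTensor F H) := by
        rw [tensorId, ContinuousLinearMap.completion_apply_coe]
        rfl
      simp only [ContinuousLinearMap.comp_apply]
      rw [hA, tensorColumn_coe, tensorColumn_coe]
      refine ext_inner_left ℂ fun u => ?_
      rw [← ContinuousLinearMap.adjoint_inner_left (T i), ContinuousLinearMap.adjoint_inner_right,
        ContinuousLinearMap.adjoint_inner_right]
      have h1 := krausOp_hasSum_inner hG (ι f) (ContinuousLinearMap.adjoint (T i) u) y
      have h2 := krausOp_hasSum_inner hG (ι (A f)) u y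
      -- The degree-zero term of the shifted vector vanishes, so its series may be reindexed from
      -- degree one and matched with the series for f.
      rw [← hasSum_nat_add_iff' 1] at h2
      simp only [Finset.range_one, Finset.sum_singleton, hzero, hsucc, zero_apply,
        inner_zero_right, sub_zero, ContinuousLinearMap.comp_apply] at h2
      simp only [ContinuousLinearMap.adjoint_inner_left] at h1
      exact h1.unique h2

theorem poissonKernel_mem_range (hT : ∀ i j, T i ∘L T j = T j ∘L T i) {b : H →L[ℂ] H}
    {G : H →L[ℂ] ColumnSpace (fun k => Fin k → Fin d) H}
    (hG : ∀ v k γ, G v k γ = b (krausOp T (R X k) γ v)) (v : H) :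
    G v ∈ Set.range (tensorColumn H (weightedDA X).subtypeₗᵢ) := by
  refine mem_range_tensorColumn X (G v)
    (fun k β => b (ContinuousLinearMap.adjoint (wordProd T β) v)) ?_ ?_
  · intro k σ α
    simp only [wordProd_comp_perm hT]
  · intro k γ
    rw [hG, krausOp, sum_apply, map_sum]
    simp only [smul_apply, map_smul]

end PoissonKernel

/-! ### From an invariant subspace to a partial isometry. -/

section InvariantSubspace

theorem wordProd_mem {H : Type*} [NormedAddCommGroup H] [InnerProductSpace ℂ H] {d : ℕ}
    {T : Fin d → H →L[ℂ] H} {S : Submodule ℂ H} (h : ∀ i, ∀ x ∈ S, T i x ∈ S) {k : ℕ}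
    (α : Fin k → Fin d) {x : H} (hx : x ∈ S) : wordProd T α x ∈ S := by
  induction k with
  | zero => simpa [wordProd] using hx
  | succ k ih =>
    rw [wordProd, List.ofFn_succ, List.prod_cons]
    exact h _ _ (ih fun j => α j.succ)

variable {H : Type*} [NormedAddCommGroup H] [InnerProductSpace ℂ H] [CompleteSpace H]
  {d : ℕ} {X : ∀ k : ℕ, WordMatrix d k} {T : Fin d → H →L[ℂ] H}

theorem starProjection_nonneg (S : Submodule ℂ H) [S.HasOrthogonalProjection] :
    0 ≤ S.starProjection :=
  (ContinuousLinearMap.nonneg_iff_isPositive _).2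
    (ContinuousLinearMap.IsPositive.of_isStarProjection isStarProjection_starProjection)

theorem starProjection_le_one (S : Submodule ℂ H) [S.HasOrthogonalProjection] :
    S.starProjection ≤ 1 := by
  have := starProjection_nonneg Sᗮ
  rw [Submodule.starProjection_orthogonal] at this
  exact sub_nonneg.1 this

/-- For an invariant subspace `S`, `Φ_T(P_S) ≤ P_S`. -/
theorem Phi_starProjection_le (hX : IsAdmissible X) (hT : IsPureContractive X T)
    (S : Submodule ℂ H) [S.HasOrthogonalProjection] (h : ∀ i, ∀ x ∈ S, T i x ∈ S) :
    Phi X T S.starProjection ≤ S.starProjection := by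
  have hproj : ∀ x, S.starProjection (S.starProjection x) = S.starProjection x := fun x =>
    Submodule.starProjection_eq_self_iff.2 (S.starProjection_apply_mem x)
  have hPhi1 : Phi X T 1 ≤ 1 := by
    refine (CStarAlgebra.norm_le_one_iff_of_nonneg _ ?_).1 hT.norm_le_one
    rw [clm_le_iff_inner_le]
    intro x
    simpa using (Phi_hasSum hX hT.converges 1 x x).nonneg fun k =>
      inner_nonneg_of_nonneg (phiTerm_nonneg hX k zero_le_one) x
  -- This is P T_α^* (I - P) = 0: the adjoints preserve S^⊥.
  have hadj : ∀ (k : ℕ) (α : Fin k → Fin d) (x : H),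
      S.starProjection (ContinuousLinearMap.adjoint (wordProd T α) x) =
        S.starProjection (ContinuousLinearMap.adjoint (wordProd T α) (S.starProjection x)) := by
    intro k α x
    rw [← sub_eq_zero, ← map_sub, ← map_sub]
    refine (Submodule.starProjection_apply_eq_zero_iff S).2 ?_
    rw [Submodule.mem_orthogonal]
    intro s hs
    rw [ContinuousLinearMap.adjoint_inner_right]
    exact (Submodule.mem_orthogonal _ _).1 (S.sub_starProjection_mem_orthogonal x) _
      (wordProd_mem h α hs)
  have hterm : ∀ (k : ℕ) (x : H), ⟪x, phiTerm X T (k + 1) S.starProjection x⟫_ℂ =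
      ⟪S.starProjection x, phiTerm X T (k + 1) S.starProjection (S.starProjection x)⟫_ℂ := by
    intro k x
    have hpp : ∀ α β : Fin (k + 1) → Fin d, ∀ x : H,
        ⟪ContinuousLinearMap.adjoint (wordProd T α) x,
          S.starProjection (ContinuousLinearMap.adjoint (wordProd T β) x)⟫_ℂ =
        ⟪S.starProjection (ContinuousLinearMap.adjoint (wordProd T α) x),
          S.starProjection (ContinuousLinearMap.adjoint (wordProd T β) x)⟫_ℂ := by
      intro α β x
      rw [S.inner_starProjection_left_eq_right, hproj]
    change ⟪x, sandwich T (X (k + 1)) S.starProjection x⟫_ℂ =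
      ⟪_, sandwich T (X (k + 1)) S.starProjection _⟫_ℂ
    rw [inner_sandwich_eq_sum, inner_sandwich_eq_sum]
    refine Finset.sum_congr rfl fun α _ => Finset.sum_congr rfl fun β _ => ?_
    rw [hpp, hpp, hadj _ α x, hadj _ β x]
  rw [clm_le_iff_inner_le]
  intro x
  have h1 : ⟪x, Phi X T S.starProjection x⟫_ℂ =
      ⟪S.starProjection x, Phi X T S.starProjection (S.starProjection x)⟫_ℂ := by
    refine (Phi_hasSum hX hT.converges _ x x).unique ?_
    rw [funext fun k => hterm k x]
    exact Phi_hasSum hX hT.converges _ _ _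
  have h2 := (clm_le_iff_inner_le _ _).1
    ((Phi_mono hX hT.converges (starProjection_le_one S)).trans hPhi1) (S.starProjection x)
  rw [h1]
  refine h2.trans_eq ?_
  change ⟪S.starProjection x, S.starProjection x⟫_ℂ = _
  rw [S.inner_starProjection_left_eq_right, hproj]

/-- An operator `V` for which `V V^*` is the projection onto `S` is a partial isometry. -/
theorem isPartialIsometry_of_comp_adjoint {K : Type*} [NormedAddCommGroup K]
    [InnerProductSpace ℂ K] [CompleteSpace K] {V : K →L[ℂ] H} {S : Submodule ℂ H}
    [S.HasOrthogonalProjection] (hV : V ∘L ContinuousLinearMap.adjoint V = S.starProjection) :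
    IsPartialIsometry V ∧ S = LinearMap.range (V : K →ₗ[ℂ] H) := by
  have hVV : ∀ x, V (ContinuousLinearMap.adjoint V x) = S.starProjection x := fun x =>
    congrArg (fun A => A x) hV
  have hmem : ∀ t, V t ∈ S := by
    intro t
    -- For z = (I - P)Vt one has ‖V^*z‖² = ⟨z, VV^*z⟩ = ⟨z, Pz⟩ = 0.
    have hz : ContinuousLinearMap.adjoint V (V t - S.starProjection (V t)) = 0 := by
      rw [← inner_self_eq_zero (𝕜 := ℂ), ContinuousLinearMap.adjoint_inner_left, hVV,
        (Submodule.starProjection_apply_eq_zero_iff S).2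
          (S.sub_starProjection_mem_orthogonal _), inner_zero_right]
    have h0 : V t - S.starProjection (V t) = 0 := by
      have h1 : ⟪V t, V t - S.starProjection (V t)⟫_ℂ = 0 := by
        rw [← ContinuousLinearMap.adjoint_inner_right, hz, inner_zero_right]
      have h2 : ⟪S.starProjection (V t), V t - S.starProjection (V t)⟫_ℂ = 0 :=
        (Submodule.mem_orthogonal _ _).1 (S.sub_starProjection_mem_orthogonal _) _
          (S.starProjection_apply_mem _)
      rw [← inner_self_eq_zero (𝕜 := ℂ), inner_sub_left, h1, h2, sub_zero]
    rw [sub_eq_zero.1 h0]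
    exact S.starProjection_apply_mem _
  have hid : ∀ s ∈ S, S.starProjection s = s := fun s hs => Submodule.starProjection_eq_self_iff.2 hs
  refine ⟨fun x hx => ?_, le_antisymm (fun s hs => ?_) ?_⟩
  · have hker : x - ContinuousLinearMap.adjoint V (V x) ∈ LinearMap.ker (V : K →ₗ[ℂ] H) := by
      rw [LinearMap.mem_ker]
      change V (x - ContinuousLinearMap.adjoint V (V x)) = 0
      rw [map_sub, hVV, hid _ (hmem x), sub_self]
    have h1 : ⟪x - ContinuousLinearMap.adjoint V (V x), x⟫_ℂ = 0 :=
      (Submodule.mem_orthogonal _ _).1 hx _ hker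
    rw [inner_sub_left, ContinuousLinearMap.adjoint_inner_left, sub_eq_zero,
      inner_self_eq_norm_sq_to_K, inner_self_eq_norm_sq_to_K] at h1
    have h2 : ‖x‖ ^ 2 = ‖V x‖ ^ 2 := by exact_mod_cast h1
    exact ((sq_eq_sq₀ (norm_nonneg _) (norm_nonneg _)).1 h2).symm
  · exact ⟨ContinuousLinearMap.adjoint V s, (hVV s).trans (hid s hs)⟩
  · rintro _ ⟨t, rfl⟩
    exact hmem t

/-- The partial isometry attached to a Poisson kernel with values in `ι(F) ⊗ H`. -/
theorem exists_partialIsometry {F : Type*} [NormedAddCommGroup F] [InnerProductSpace ℂ F]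
    (ι : F →ₗᵢ[ℂ] Fock d) {W : Fin d → F →L[ℂ] F}
    (hzero : ∀ i f, evalWord T (ROp X 0 (ι (W i f) 0)) = 0)
    (hsucc : ∀ i f k, evalWord T (ROp X (k + 1) (ι (W i f) (k + 1))) =
      T i ∘L evalWord T (ROp X k (ι f k))) {b : H →L[ℂ] H}
    {G : H →L[ℂ] ColumnSpace (fun k => Fin k → Fin d) H}
    (hG : ∀ v k γ, G v k γ = b (krausOp T (R X k) γ v))
    (hrange : ∀ v, G v ∈ Set.range (tensorColumn H ι)) {S : Submodule ℂ H}
    [S.HasOrthogonalProjection] (hGG : ContinuousLinearMap.adjoint G ∘L G = S.starProjection) :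
    ∃ V : HilbertTensor F H →L[ℂ] H, IsPartialIsometry V ∧
      (∀ i, T i ∘L V = V ∘L tensorId H (W i)) ∧
      S = LinearMap.range (V : HilbertTensor F H →ₗ[ℂ] H) := by
  -- With J = `tensorColumn H ι`, the operator JJ^* is the identity on the range of J, which
  -- contains that of G; hence G^*JJ^*G = G^*G.
  have hV : (ContinuousLinearMap.adjoint G ∘L tensorColumn H ι) ∘L
      ContinuousLinearMap.adjoint (ContinuousLinearMap.adjoint G ∘L tensorColumn H ι) =
      S.starProjection := by
    rw [ContinuousLinearMap.adjoint_comp, ContinuousLinearMap.adjoint_adjoint, ← hGG]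
    ext v
    obtain ⟨t, ht⟩ := hrange v
    simp only [ContinuousLinearMap.comp_apply]
    rw [← ht, adjoint_tensorColumn_apply]
  obtain ⟨h1, h2⟩ := isPartialIsometry_of_comp_adjoint hV
  exact ⟨_, h1, fun i => poissonKernel_intertwines ι (hzero i) (hsucc i) hG, h2⟩

end InvariantSubspace

end WeightedDruryArveson

theorem theorem4p2 {d : ℕ} (hd : 0 < d)
    {X : ∀ k : ℕ, WeightedDruryArveson.WordMatrix d k}
    (hX : WeightedDruryArveson.IsAdmissible X)
    {H : Type u} [NormedAddCommGroup H] [InnerProductSpace ℂ H] [CompleteSpace H]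
    (T : Fin d → H →L[ℂ] H) (hT : WeightedDruryArveson.IsPureContractive X T)
    (S : Submodule ℂ H) (hS : IsClosed (S : Set H)) :
    (∀ i, ∀ x ∈ S, T i x ∈ S) ↔
      ∃ (D : Type u) (_ : NormedAddCommGroup D) (_ : InnerProductSpace ℂ D) (_ : CompleteSpace D)
        (V : WeightedDruryArveson.HilbertTensor (WeightedDruryArveson.weightedDA X) D →L[ℂ] H),
        WeightedDruryArveson.IsPartialIsometry
          (K := WeightedDruryArveson.HilbertTensor (WeightedDruryArveson.weightedDA X) D) V ∧
        (∀ i, T i ∘L V =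
          V ∘L WeightedDruryArveson.tensorId D (WeightedDruryArveson.weightedShift hX i)) ∧
        S = LinearMap.range
          (V : WeightedDruryArveson.HilbertTensor (WeightedDruryArveson.weightedDA X) D →ₗ[ℂ] H) := by
  open WeightedDruryArveson in
  constructor
  · intro h
    have : CompleteSpace S := hS.completeSpace_coe
    obtain ⟨b, G, hG, hGG⟩ := exists_poissonKernel hX hT (starProjection_nonneg S)
      (starProjection_le_one S)
      (Phi_starProjection_le hX hT S h)
    -- The coefficient space is H itself, because b acts on H.
    exact ⟨H, inferInstance, inferInstance, inferInstance,
      exists_partialIsometry (weightedDA X).subtypeₗᵢ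
        (fun i f => evalWord_weightedShift_zero hX hT.commute i f)
        (fun i f k => evalWord_weightedShift_succ hX hT.commute i f k) hG
        (poissonKernel_mem_range hT.commute hG) hGG⟩
  · rintro ⟨D, _, _, _, V, -, hV, rfl⟩ i _ ⟨t, rfl⟩
    exact ⟨tensorId D (weightedShift hX i) t, (congrArg (fun A => A t) (hV i)).symm⟩
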